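/- Let $\mathbb{K}$ be a field of characteristic zero and $\mathcal{D}$ a set. A \emph{partitioned tree} decorated by $\mathcal{D}$ is a finite nonempty rooted forest, with vertices decorated by elements of $\mathcal{D}$, together with a partition of its vertices into blocks such that all the roots form one block and two non-root vertices in the same block have the same parent. Let $ComPrelie(\mathcal{D})$ be the $\mathbb{K}$-vector space with basis the isomorphism classes of such partitioned trees, with the bilinear products defined on basis elements as follows: $t \mathbin{\sqcup\!\!\sqcup} t'$ is the disjoint union of $t$ and $t'$ with the two root blocks merged into one block; $t\bullet t'$ is the sum, over all vertices $s$ of $t$, of the partitioned trees obtained by grafting all the roots of $t'$ on $s$ (the blocks of $t$ and of $t'$ being kept). Let $Prelie(\mathcal{D})\subseteq ComPrelie(\mathcal{D})$ be the subspace with basis the rooted trees, i.e. the partitioned trees all of whose blocks have cardinality one; it is stable under $\bullet$ (it is the rooted tree model of the free pre-Lie algebra on $\mathcal{D}$). Let $\mathfrak{h}_{\mathcal{D}}$ be the (non-unital) subalgebra of $(ComPrelie(\mathcal{D}),\sqcup\!\!\sqcup)$ generated by $Prelie(\mathcal{D})$. Let $V_{\mathcal{D}}$ be the space with basis the biletters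 $\binom{k}{d}$, $k\in\mathbb{N}$, $d\in\mathcal{D}$, and $f_{\mathcal{D}}$ its endomorphism $\binom{k}{d}\mapsto\binom{k+1}{d}$. Let $T(V_{\mathcal{D}},f_{\mathcal{D}})$ be the space $T(V_{\mathcal{D}})$ of linear combinations of words in biletters, with the shuffle product $\sqcup\!\!\sqcup$ and the bilinear product $\bullet$ defined by $\emptyset\bullet w'=0$ and $xw\bullet w'=x(w\bullet w')+f_{\mathcal{D}}(x)(w\mathbin{\sqcup\!\!\sqcup} w')$ for $x\in V_{\mathcal{D}}$, $w,w'\in T(V_{\mathcal{D}})$. Then there is a unique linear map $\Phi_{CPL}:ComPrelie(\mathcal{D})\to T(V_{\mathcal{D}},f_{\mathcal{D}})$ that is compatible with $\sqcup\!\!\sqcup$ and $\bullet$ and sends the one-vertex tree decorated by $d$ to $\binom{0}{d}$ for all $d\in\mathcal{D}$; there is a unique linear map $\Phi_{PL}:Prelie(\mathcal{D})\to T(V_{\mathcal{D}},f_{\mathcal{D}})$ that is compatible with $\bullet$ and sends the one-vertex tree decorated by $d$ to $\binom{0}{d}$ for all $d\in\mathcal{D}$; and $\Phi_{PL}$ is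 the restriction of $\Phi_{CPL}$ to $Prelie(\mathcal{D})$. Moreover $\Phi_{PL}$ is injective, and the restriction of $\Phi_{CPL}$ to $\mathfrak{h}_{\mathcal{D}}$ is injective. -/

import Mathlib

universe u v w

/-! ### Partitioned trees decorated by `D`

A partitioned tree is a nonempty block of roots; every vertex carries a decoration and a finite
collection of blocks of children, and no order is put on the vertices of a block nor on the blocks of
children of a vertex.  Planar representatives come first; isomorphism classes are obtained from them
by forgetting these orders. -/

mutual
/-- A planar decorated partitioned tree: a nonempty list of roots, all in the same block. A root is
given by its decoration `d` and the list `c` of the blocks of its children. -/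
inductive PlanarBlock (D : Type u) : Type u
  /-- the block consists of one vertex -/
  | single (d : D) (c : PlanarBlocks D) : PlanarBlock D
  /-- a vertex followed by the remaining vertices of the block -/
  | cons (d : D) (c : PlanarBlocks D) (b : PlanarBlock D) : PlanarBlock D
/-- A finite, possibly empty list of blocks (with everything above them). -/
inductive PlanarBlocks (D : Type u) : Type u
  | nil : PlanarBlocks D
  | cons (b : PlanarBlock D) (F : PlanarBlocks D) : PlanarBlocks D
end

mutual
/-- Two planar partitioned trees are isomorphic: the smallest congruence that allows the exchange of
neighbouring vertices of a block and of neighbouring blocks of children of a vertex. -/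
inductive PlanarBlock.Iso {D : Type u} : PlanarBlock D → PlanarBlock D → Prop
  | refl (b : PlanarBlock D) : PlanarBlock.Iso b b
  | symm {b b' : PlanarBlock D} : PlanarBlock.Iso b b' → PlanarBlock.Iso b' b
  | trans {b b' b'' : PlanarBlock D} :
      PlanarBlock.Iso b b' → PlanarBlock.Iso b' b'' → PlanarBlock.Iso b b''
  | single (d : D) {c c' : PlanarBlocks D} :
      PlanarBlocks.Iso c c' → PlanarBlock.Iso (.single d c) (.single d c')
  | cons (d : D) {c c' : PlanarBlocks D} {b b' : PlanarBlock D} :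
      PlanarBlocks.Iso c c' → PlanarBlock.Iso b b' → PlanarBlock.Iso (.cons d c b) (.cons d c' b')
  | swapLast (d e : D) (c c' : PlanarBlocks D) :
      PlanarBlock.Iso (.cons d c (.single e c')) (.cons e c' (.single d c))
  | swap (d e : D) (c c' : PlanarBlocks D) (b : PlanarBlock D) :
      PlanarBlock.Iso (.cons d c (.cons e c' b)) (.cons e c' (.cons d c b))
/-- The same for lists of blocks. -/
inductive PlanarBlocks.Iso {D : Type u} : PlanarBlocks D → PlanarBlocks D → Prop
  | refl (F : PlanarBlocks D) : PlanarBlocks.Iso F F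
  | symm {F F' : PlanarBlocks D} : PlanarBlocks.Iso F F' → PlanarBlocks.Iso F' F
  | trans {F F' F'' : PlanarBlocks D} :
      PlanarBlocks.Iso F F' → PlanarBlocks.Iso F' F'' → PlanarBlocks.Iso F F''
  | cons {b b' : PlanarBlock D} {F F' : PlanarBlocks D} :
      PlanarBlock.Iso b b' → PlanarBlocks.Iso F F' → PlanarBlocks.Iso (.cons b F) (.cons b' F')
  | swap (b b' : PlanarBlock D) (F : PlanarBlocks D) :
      PlanarBlocks.Iso (.cons b (.cons b' F)) (.cons b' (.cons b F))
end

instance PlanarBlock.setoid (D : Type u) : Setoid (PlanarBlock D) where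
  r := PlanarBlock.Iso
  iseqv := ⟨.refl, .symm, .trans⟩

instance PlanarBlocks.setoid (D : Type u) : Setoid (PlanarBlocks D) where
  r := PlanarBlocks.Iso
  iseqv := ⟨.refl, .symm, .trans⟩

/-- Isomorphism classes of partitioned trees decorated by `D`. -/
def PartTree (D : Type u) : Type u := Quotient (PlanarBlock.setoid D)

/-- The isomorphism class of a planar partitioned tree. -/
def PartTree.mk {D : Type u} (b : PlanarBlock D) : PartTree D := Quotient.mk _ b

/-- The tree with a single vertex, decorated by `d`. -/
def PartTree.dot {D : Type u} (d : D) : PartTree D := .mk (.single d .nil)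

/-- The union of two partitioned trees, the two root blocks being merged into one block. -/
def PlanarBlock.merge {D : Type u} : PlanarBlock D → PlanarBlock D → PlanarBlock D
  | .single d c, b' => .cons d c b'
  | .cons d c b, b' => .cons d c (b.merge b')

mutual
/-- The multiset of all graftings of `t` on a vertex `s` of the first argument, where `s` runs over
all its vertices: the root block of `t` becomes a new block of children of `s`. -/
def PlanarBlock.graft {D : Type u} (t : PlanarBlock D) : PlanarBlock D → Multiset (PlanarBlock D)
  | .single d c =>
      {.single d (.cons t c)} + (PlanarBlocks.graft t c).map (fun c' => .single d c')
  | .cons d c b =>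
      {.cons d (.cons t c) b} + (PlanarBlocks.graft t c).map (fun c' => .cons d c' b) +
        (PlanarBlock.graft t b).map (fun b' => .cons d c b')
/-- The same for lists of blocks. -/
def PlanarBlocks.graft {D : Type u} (t : PlanarBlock D) : PlanarBlocks D → Multiset (PlanarBlocks D)
  | .nil => 0
  | .cons b F =>
      (PlanarBlock.graft t b).map (fun b' => .cons b' F) +
        (PlanarBlocks.graft t F).map (fun F' => .cons b F')
end

/-! Compatibility of these operations with isomorphisms. -/

theorem PlanarBlock.Iso.merge_left {D : Type u} {b b' : PlanarBlock D} (h : b.Iso b')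
    (a : PlanarBlock D) : (b.merge a).Iso (b'.merge a) :=
  match h with
  | .refl _ => .refl _
  | .symm h => .symm (h.merge_left a)
  | .trans h h' => .trans (h.merge_left a) (h'.merge_left a)
  | .single d h => .cons d h (.refl a)
  | .cons d h h' => .cons d h (h'.merge_left a)
  | .swapLast d e c c' => .swap d e c c' a
  | .swap d e c c' b => .swap d e c c' (b.merge a)

theorem PlanarBlock.Iso.merge_right {D : Type u} (b : PlanarBlock D) {a a' : PlanarBlock D}
    (h : a.Iso a') : (b.merge a).Iso (b.merge a') :=
  match b with
  | .single d c => .cons d (.refl c) h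
  | .cons d c b => .cons d (.refl c) (PlanarBlock.Iso.merge_right b h)

/-- The class of a vertex with children, as a function of the class of its blocks of children. -/
def PartTree.single {D : Type u} (d : D) : Quotient (PlanarBlocks.setoid D) → PartTree D :=
  Quotient.lift (fun c => .mk (.single d c)) fun _ _ h => Quotient.sound (.single d h)

/-- Adding a vertex to the root block, on classes. -/
def PartTree.cons {D : Type u} (d : D) :
    Quotient (PlanarBlocks.setoid D) → PartTree D → PartTree D :=
  Quotient.lift₂ (fun c b => .mk (.cons d c b)) fun _ _ _ _ h h' => Quotient.sound (.cons d h h')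

/-- Adding a block, on classes. -/
def PartTree.consBlock {D : Type u} :
    PartTree D → Quotient (PlanarBlocks.setoid D) → Quotient (PlanarBlocks.setoid D) :=
  Quotient.lift₂ (fun b F => Quotient.mk _ (.cons b F)) fun _ _ _ _ h h' =>
    Quotient.sound (.cons h h')

theorem PartTree.consBlock_comm {D : Type u} (x y : PartTree D)
    (z : Quotient (PlanarBlocks.setoid D)) :
    consBlock x (consBlock y z) = consBlock y (consBlock x z) := by
  induction x using Quotient.inductionOn
  induction y using Quotient.inductionOn
  induction z using Quotient.inductionOn
  exact Quotient.sound (.swap _ _ _)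

theorem PartTree.cons_single_comm {D : Type u} (d e : D) (x y : Quotient (PlanarBlocks.setoid D)) :
    cons d x (single e y) = cons e y (single d x) := by
  induction x using Quotient.inductionOn
  induction y using Quotient.inductionOn
  exact Quotient.sound (.swapLast _ _ _ _)

theorem PartTree.cons_cons_comm {D : Type u} (d e : D) (x y : Quotient (PlanarBlocks.setoid D))
    (z : PartTree D) : cons d x (cons e y z) = cons e y (cons d x z) := by
  induction x using Quotient.inductionOn
  induction y using Quotient.inductionOn
  induction z using Quotient.inductionOn
  exact Quotient.sound (.swap _ _ _ _ _)

/-- The classes of the graftings of `t` on the vertices of a planar partitioned tree. -/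
def PlanarBlock.graftClass {D : Type u} (t b : PlanarBlock D) : Multiset (PartTree D) :=
  (PlanarBlock.graft t b).map PartTree.mk

/-- The same for lists of blocks. -/
def PlanarBlocks.graftClass {D : Type u} (t : PlanarBlock D) (F : PlanarBlocks D) :
    Multiset (Quotient (PlanarBlocks.setoid D)) :=
  (PlanarBlocks.graft t F).map (Quotient.mk _)

theorem PlanarBlock.graftClass_single {D : Type u} (t : PlanarBlock D) (d : D)
    (c : PlanarBlocks D) :
    graftClass t (.single d c) =
      {PartTree.single d (PartTree.consBlock (.mk t) (Quotient.mk _ c))} +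
        (PlanarBlocks.graftClass t c).map (PartTree.single d) := by
  simp only [graftClass, PlanarBlocks.graftClass, PlanarBlock.graft, Multiset.map_add,
    Multiset.map_map, Multiset.map_singleton]
  rfl

theorem PlanarBlock.graftClass_cons {D : Type u} (t : PlanarBlock D) (d : D)
    (c : PlanarBlocks D) (b : PlanarBlock D) :
    graftClass t (.cons d c b) =
      {PartTree.cons d (PartTree.consBlock (.mk t) (Quotient.mk _ c)) (.mk b)} +
        (PlanarBlocks.graftClass t c).map (fun x => PartTree.cons d x (.mk b)) +
        (graftClass t b).map (PartTree.cons d (Quotient.mk _ c)) := by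
  simp only [graftClass, PlanarBlocks.graftClass, PlanarBlock.graft, Multiset.map_add,
    Multiset.map_map, Multiset.map_singleton]
  rfl

theorem PlanarBlocks.graftClass_cons {D : Type u} (t b : PlanarBlock D) (F : PlanarBlocks D) :
    graftClass t (.cons b F) =
      (PlanarBlock.graftClass t b).map (fun x => PartTree.consBlock x (Quotient.mk _ F)) +
        (graftClass t F).map (PartTree.consBlock (.mk b)) := by
  simp only [PlanarBlock.graftClass, graftClass, PlanarBlocks.graft, Multiset.map_add,
    Multiset.map_map]
  rfl

mutual
theorem PlanarBlock.graftClass_congr_left {D : Type u} {t t' : PlanarBlock D} (h : t.Iso t') :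
    (b : PlanarBlock D) → PlanarBlock.graftClass t b = PlanarBlock.graftClass t' b
  | .single d c => by
      have e : PartTree.mk t = PartTree.mk t' := Quotient.sound h
      rw [PlanarBlock.graftClass_single, PlanarBlock.graftClass_single, PlanarBlocks.graftClass_congr_left h c, e]
  | .cons d c b => by
      have e : PartTree.mk t = PartTree.mk t' := Quotient.sound h
      rw [PlanarBlock.graftClass_cons, PlanarBlock.graftClass_cons, PlanarBlocks.graftClass_congr_left h c,
        PlanarBlock.graftClass_congr_left h b, e]
theorem PlanarBlocks.graftClass_congr_left {D : Type u} {t t' : PlanarBlock D} (h : t.Iso t') :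
    (F : PlanarBlocks D) → PlanarBlocks.graftClass t F = PlanarBlocks.graftClass t' F
  | .nil => rfl
  | .cons b F => by
      rw [PlanarBlocks.graftClass_cons, PlanarBlocks.graftClass_cons, PlanarBlock.graftClass_congr_left h b,
        PlanarBlocks.graftClass_congr_left h F]
end

mutual
theorem PlanarBlock.graftClass_congr_right {D : Type u} (t : PlanarBlock D) :
    {b b' : PlanarBlock D} → b.Iso b' → PlanarBlock.graftClass t b = PlanarBlock.graftClass t b'
  | _, _, .refl _ => rfl
  | _, _, .symm h => (PlanarBlock.graftClass_congr_right t h).symm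
  | _, _, .trans h h' =>
      (PlanarBlock.graftClass_congr_right t h).trans (PlanarBlock.graftClass_congr_right t h')
  | _, _, .single (c := c) (c' := c') d h => by
      have e : (Quotient.mk _ c : Quotient (PlanarBlocks.setoid D)) = Quotient.mk _ c' :=
        Quotient.sound h
      rw [PlanarBlock.graftClass_single, PlanarBlock.graftClass_single, PlanarBlocks.graftClass_congr_right t h, e]
  | _, _, .cons (c := c) (c' := c') (b := b) (b' := b') d h h' => by
      have e : (Quotient.mk _ c : Quotient (PlanarBlocks.setoid D)) = Quotient.mk _ c' :=
        Quotient.sound h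
      have e' : PartTree.mk b = PartTree.mk b' := Quotient.sound h'
      rw [PlanarBlock.graftClass_cons, PlanarBlock.graftClass_cons, PlanarBlocks.graftClass_congr_right t h,
        PlanarBlock.graftClass_congr_right t h', e, e']
  | _, _, .swapLast d e c c' => by
      have k (d : D) (c : PlanarBlocks D) :
        PartTree.mk (.single d c) = PartTree.single d (Quotient.mk _ c) := rfl
      simp only [PlanarBlock.graftClass_cons, PlanarBlock.graftClass_single, Multiset.map_add, Multiset.map_map,
        Multiset.map_singleton, Function.comp_def, k, PartTree.cons_single_comm e d]
      abel
  | _, _, .swap d e c c' b => by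
      have k (d : D) (c : PlanarBlocks D) (b : PlanarBlock D) :
        PartTree.mk (.cons d c b) = PartTree.cons d (Quotient.mk _ c) (.mk b) := rfl
      simp only [PlanarBlock.graftClass_cons, Multiset.map_add, Multiset.map_map,
        Multiset.map_singleton, Function.comp_def, k, PartTree.cons_cons_comm e d]
      abel
theorem PlanarBlocks.graftClass_congr_right {D : Type u} (t : PlanarBlock D) :
    {F F' : PlanarBlocks D} → F.Iso F' → PlanarBlocks.graftClass t F = PlanarBlocks.graftClass t F'
  | _, _, .refl _ => rfl
  | _, _, .symm h => (PlanarBlocks.graftClass_congr_right t h).symm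
  | _, _, .trans h h' =>
      (PlanarBlocks.graftClass_congr_right t h).trans (PlanarBlocks.graftClass_congr_right t h')
  | _, _, .cons (b := b) (b' := b') (F := F) (F' := F') h h' => by
      have e : (Quotient.mk _ F : Quotient (PlanarBlocks.setoid D)) = Quotient.mk _ F' :=
        Quotient.sound h'
      have e' : PartTree.mk b = PartTree.mk b' := Quotient.sound h
      rw [PlanarBlocks.graftClass_cons, PlanarBlocks.graftClass_cons, PlanarBlock.graftClass_congr_right t h,
        PlanarBlocks.graftClass_congr_right t h', e, e']
  | _, _, .swap b b' F => by
      have k (b : PlanarBlock D) (F : PlanarBlocks D) :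
        (Quotient.mk _ (.cons b F) : Quotient (PlanarBlocks.setoid D)) =
          PartTree.consBlock (.mk b) (Quotient.mk _ F) := rfl
      have hb : (fun x => PartTree.consBlock (.mk b) (PartTree.consBlock x (Quotient.mk _ F))) =
          fun x => PartTree.consBlock x (PartTree.consBlock (.mk b) (Quotient.mk _ F)) :=
        funext fun x => PartTree.consBlock_comm _ _ _
      simp only [PlanarBlocks.graftClass_cons, Multiset.map_add, Multiset.map_map, Function.comp_def, k]
      simp only [hb, PartTree.consBlock_comm (.mk b') _ _]
      abel
end

/-- The commutative product of two partitioned trees: union, with the root blocks merged. -/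
def PartTree.merge {D : Type u} : PartTree D → PartTree D → PartTree D :=
  Quotient.map₂ PlanarBlock.merge fun b _ h _ a' h' =>
    .trans (PlanarBlock.Iso.merge_right b h') (h.merge_left a')

/-- The multiset of the partitioned trees `t •ₛ t'`, where `s` runs over the vertices of `t`. -/
def PartTree.graft {D : Type u} : PartTree D → PartTree D → Multiset (PartTree D) :=
  Quotient.lift₂ (fun t t' => PlanarBlock.graftClass t' t) fun _ _ _ b' h h' =>
    (PlanarBlock.graftClass_congr_left h' _).trans (PlanarBlock.graftClass_congr_right b' h)

mutual
/-- All blocks have cardinality one, i.e. the partitioned tree is a rooted tree. -/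
def PlanarBlock.IsRootedTree {D : Type u} : PlanarBlock D → Prop
  | .single _ c => c.AreRootedTrees
  | .cons _ _ _ => False
/-- The same for every block of a list. -/
def PlanarBlocks.AreRootedTrees {D : Type u} : PlanarBlocks D → Prop
  | .nil => True
  | .cons b F => b.IsRootedTree ∧ F.AreRootedTrees
end

/-- Rooted trees, identified with the partitioned trees all of whose blocks have cardinality one. -/
def PartTree.IsRootedTree {D : Type u} (t : PartTree D) : Prop :=
  ∃ b : PlanarBlock D, b.IsRootedTree ∧ PartTree.mk b = t

mutual
theorem PlanarBlock.IsRootedTree.graft {D : Type u} {t : PlanarBlock D} (ht : t.IsRootedTree) :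
    (b : PlanarBlock D) → b.IsRootedTree → ∀ s ∈ PlanarBlock.graft t b, s.IsRootedTree
  | .single d c, hb, s, hs => by
      simp only [PlanarBlock.graft, Multiset.mem_add, Multiset.mem_singleton,
        Multiset.mem_map] at hs
      obtain rfl | ⟨c', hc', rfl⟩ := hs
      · exact ⟨ht, hb⟩
      · exact PlanarBlocks.AreRootedTrees.graft ht c hb c' hc'
  | .cons _ _ _, hb, _, _ => hb.elim
theorem PlanarBlocks.AreRootedTrees.graft {D : Type u} {t : PlanarBlock D} (ht : t.IsRootedTree) :
    (F : PlanarBlocks D) → F.AreRootedTrees → ∀ s ∈ PlanarBlocks.graft t F, s.AreRootedTrees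
  | .nil, _, s, hs => by simp [PlanarBlocks.graft] at hs
  | .cons b F, hF, s, hs => by
      simp only [PlanarBlocks.graft, Multiset.mem_add, Multiset.mem_map] at hs
      obtain ⟨b', hb', rfl⟩ | ⟨F', hF', rfl⟩ := hs
      · exact ⟨PlanarBlock.IsRootedTree.graft ht b hF.1 b' hb', hF.2⟩
      · exact ⟨hF.1, PlanarBlocks.AreRootedTrees.graft ht F hF.2 F' hF'⟩
end

theorem PartTree.IsRootedTree.graft {D : Type u} {t t' : PartTree D} (h : t.IsRootedTree)
    (h' : t'.IsRootedTree) : ∀ s ∈ PartTree.graft t t', s.IsRootedTree := by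
  obtain ⟨b, hb, rfl⟩ := h
  obtain ⟨b', hb', rfl⟩ := h'
  intro s hs
  obtain ⟨a, ha, rfl⟩ := Multiset.mem_map.1 hs
  exact ⟨a, hb'.graft b hb a ha, rfl⟩

/-! ### The Com-Pre-Lie algebra of partitioned trees and the pre-Lie algebra of rooted trees -/

noncomputable section

/-- The vector space with basis the partitioned trees decorated by `D`. -/
abbrev ComPrelie (K : Type v) [Field K] (D : Type u) : Type (max u v) := PartTree D →₀ K

/-- The commutative product of `ComPrelie K D`. -/
def ComPrelie.shuffle (K : Type v) [Field K] (D : Type u) :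
    ComPrelie K D →ₗ[K] ComPrelie K D →ₗ[K] ComPrelie K D :=
  Finsupp.linearCombination K fun t =>
    Finsupp.linearCombination K fun t' => Finsupp.single (t.merge t') 1

/-- The pre-Lie product of `ComPrelie K D`: `t • t'` is the sum, over the vertices `s` of `t`, of the
graftings of `t'` on `s`. -/
def ComPrelie.preLie (K : Type v) [Field K] (D : Type u) :
    ComPrelie K D →ₗ[K] ComPrelie K D →ₗ[K] ComPrelie K D :=
  Finsupp.linearCombination K fun t =>
    Finsupp.linearCombination K fun t' => ((t.graft t').map fun s => Finsupp.single s (1 : K)).sum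

/-- The one-vertex tree decorated by `d`, as an element of `ComPrelie K D`. -/
def ComPrelie.dot (K : Type v) [Field K] {D : Type u} (d : D) : ComPrelie K D :=
  Finsupp.single (PartTree.dot d) 1

/-- The space with basis the rooted trees decorated by `D`, inside `ComPrelie K D`. -/
def Prelie (K : Type v) [Field K] (D : Type u) : Submodule K (ComPrelie K D) :=
  Submodule.span K {x | ∃ t : PartTree D, t.IsRootedTree ∧ x = Finsupp.single t 1}

theorem Prelie.preLie_mem {K : Type v} [Field K] {D : Type u} {x y : ComPrelie K D}
    (hx : x ∈ Prelie K D) (hy : y ∈ Prelie K D) : ComPrelie.preLie K D x y ∈ Prelie K D := by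
  refine LinearMap.BilinMap.apply_apply_mem_of_mem_span (Prelie K D) _ _ (ComPrelie.preLie K D)
    ?_ x y hx hy
  rintro _ ⟨t, ht, rfl⟩ _ ⟨t', ht', rfl⟩
  simp only [ComPrelie.preLie, Finsupp.linearCombination_single, one_smul]
  refine multiset_sum_mem _ fun z hz => ?_
  obtain ⟨s, hs, rfl⟩ := Multiset.mem_map.1 hz
  exact Submodule.subset_span ⟨s, ht.graft ht' s hs, rfl⟩

theorem Prelie.dot_mem (K : Type v) [Field K] {D : Type u} (d : D) :
    ComPrelie.dot K d ∈ Prelie K D :=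
  Submodule.subset_span ⟨PartTree.dot d, ⟨.single d .nil, trivial, rfl⟩, rfl⟩

/-- The one-vertex tree decorated by `d`, as an element of `Prelie K D`. -/
def Prelie.dot (K : Type v) [Field K] {D : Type u} (d : D) : Prelie K D :=
  ⟨ComPrelie.dot K d, Prelie.dot_mem K d⟩

/-- The pre-Lie product of `Prelie K D` (grafting of rooted trees). -/
def Prelie.preLie {K : Type v} [Field K] {D : Type u} (x y : Prelie K D) : Prelie K D :=
  ⟨ComPrelie.preLie K D x y, Prelie.preLie_mem x.2 y.2⟩

/-- The (non-unital) subalgebra of `ComPrelie K D` for the commutative product generated by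
`Prelie K D`; it is spanned by the rooted forests, the roots of a forest forming one block. -/
def forestAlgebra (K : Type v) [Field K] (D : Type u) : Submodule K (ComPrelie K D) :=
  sInf {S | Prelie K D ≤ S ∧ ∀ x ∈ S, ∀ y ∈ S, ComPrelie.shuffle K D x y ∈ S}

/-! ### The Com-Pre-Lie algebra `T(V, f)` for a space `V` with basis `X` -/

/-- `T(V)`, where `V` has basis `X`: the space with basis the words in `X`. -/
abbrev TensorWords (K : Type v) [Field K] (X : Type w) : Type (max v w) := List X →₀ K

/-- The concatenation `x w` of a vector `x` of `V` and an element `w` of `T(V)`. -/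
def TensorWords.cons (K : Type v) [Field K] (X : Type w) :
    (X →₀ K) →ₗ[K] TensorWords K X →ₗ[K] TensorWords K X :=
  Finsupp.linearCombination K fun x => Finsupp.lmapDomain K K (List.cons x)

/-- The shuffle product of two words. -/
def TensorWords.shuffleWord (K : Type v) [Field K] {X : Type w} :
    List X → List X → TensorWords K X
  | [], v => Finsupp.single v 1
  | x :: u, [] => Finsupp.single (x :: u) 1
  | x :: u, y :: v =>
      TensorWords.cons K X (Finsupp.single x 1) (TensorWords.shuffleWord K u (y :: v)) +
        TensorWords.cons K X (Finsupp.single y 1) (TensorWords.shuffleWord K (x :: u) v)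
termination_by u v => u.length + v.length

/-- The product `∅ • w' = 0`, `x w • w' = x (w • w') + f(x) (w ⧢ w')` of two words. -/
def TensorWords.preLieWord {K : Type v} [Field K] {X : Type w} (f : (X →₀ K) →ₗ[K] (X →₀ K)) :
    List X → List X → TensorWords K X
  | [], _ => 0
  | x :: w, w' =>
      TensorWords.cons K X (Finsupp.single x 1) (TensorWords.preLieWord f w w') +
        TensorWords.cons K X (f (Finsupp.single x 1)) (TensorWords.shuffleWord K w w')

/-- The shuffle product of `T(V)`. -/
def TensorWords.shuffle (K : Type v) [Field K] (X : Type w) :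
    TensorWords K X →ₗ[K] TensorWords K X →ₗ[K] TensorWords K X :=
  Finsupp.linearCombination K fun u =>
    Finsupp.linearCombination K fun v => TensorWords.shuffleWord K u v

/-- The pre-Lie product of `T(V, f)`. -/
def TensorWords.preLie {K : Type v} [Field K] {X : Type w} (f : (X →₀ K) →ₗ[K] (X →₀ K)) :
    TensorWords K X →ₗ[K] TensorWords K X →ₗ[K] TensorWords K X :=
  Finsupp.linearCombination K fun u =>
    Finsupp.linearCombination K fun v => TensorWords.preLieWord f u v

/-! ### The generic case: biletters -/

/-- The endomorphism `(k, d) ↦ (k + 1, d)` of the space `V_D` with basis the biletters `ℕ × D`. -/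
def biletterShift (K : Type v) [Field K] (D : Type u) : ((ℕ × D) →₀ K) →ₗ[K] ((ℕ × D) →₀ K) :=
  Finsupp.lmapDomain K K fun p => (p.1 + 1, p.2)

/-- The space of `T(V_D, f_D)`, with basis the biwords. -/
abbrev Biwords (K : Type v) [Field K] (D : Type u) : Type (max v u) := TensorWords K (ℕ × D)

/-- The biletter `(k, d)`, as a biword of length one. -/
def biletter (K : Type v) [Field K] {D : Type u} (k : ℕ) (d : D) : Biwords K D :=
  Finsupp.single [(k, d)] 1

/-- `Φ` is a Com-Pre-Lie morphism from `ComPrelie K D` to `T(V_D, f_D)` that sends each one-vertex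
tree `d` to the biletter `(0, d)`. -/
structure IsPhiCPL {K : Type v} [Field K] {D : Type u} (Φ : ComPrelie K D →ₗ[K] Biwords K D) :
    Prop where
  map_shuffle : ∀ x y, Φ (ComPrelie.shuffle K D x y) = TensorWords.shuffle K (ℕ × D) (Φ x) (Φ y)
  map_preLie : ∀ x y,
    Φ (ComPrelie.preLie K D x y) = TensorWords.preLie (biletterShift K D) (Φ x) (Φ y)
  map_dot : ∀ d, Φ (ComPrelie.dot K d) = biletter K 0 d

/-- `φ` is a pre-Lie morphism from `Prelie K D` to `T(V_D, f_D)` that sends each one-vertex tree `d`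
to the biletter `(0, d)`. -/
structure IsPhiPL {K : Type v} [Field K] {D : Type u} (φ : Prelie K D →ₗ[K] Biwords K D) :
    Prop where
  map_preLie : ∀ x y, φ (Prelie.preLie x y) = TensorWords.preLie (biletterShift K D) (φ x) (φ y)
  map_dot : ∀ d, φ (Prelie.dot K d) = biletter K 0 d

end

-- Existence is an explicit formula. A vertex decorated by `d` with `k` blocks of children is sent
-- to the letter `(k, d)` followed by the shuffle of the images of these blocks, and a root block to
-- the shuffle of the images of its vertices. In `T(V, f)`, right multiplication by `•` is a
-- derivation of the shuffle (`shuffle_preLie`). Grafting on a root adds one block, which is the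
-- term `f(x)(w ⧢ w')`; grafting higher up leaves `k` unchanged, which is the term `x(w • w')`.
--
-- Uniqueness holds because the one-vertex trees generate. If `B_d(F)` denotes the blocks `F`
-- grafted on a common root `d`, then `B_d(yF) = B_d(F) • y - B_d(F • y)`, and both terms on the
-- right involve one block less at the root (`addRoot_mem`).
--
-- Injectivity comes from cutting off first letters. Erasing the first letter `(k, d)` is a
-- derivation of the shuffle, and on the image of a forest it amounts to the removal of a root
-- decorated by `d` with `k` blocks of children (`headDeriv_forestBiword`). If a combination `P` of
-- rooted forests has image zero, so has each of its derivatives, which have fewer vertices and so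
-- vanish by induction. Suppose that `P` is not supported on the empty forest. Among all trees of
-- all forests in the support of `P`, take one with the fewest vertices, with root `r`, in a forest
-- `s`. The forest obtained by removing `r` from `s` determines `r` and `s`: the trees smaller than
-- that of `r` in it are exactly the children of `r` (`IsRootedForest.eq_of_removeRoot_eq`). Its
-- coefficient in the derivative is therefore `P s` times the multiplicity of `r` in `s`, which is
-- nonzero in characteristic zero: a contradiction. So `P` is a multiple of the empty forest, whose
-- image is the empty word, and `P = 0`.

namespace TensorWords

-- Algebra of the shuffle and pre-Lie products on words

variable {K : Type v} [Field K] {X : Type w}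

theorem induction_basis {ι : Type*} {P : (ι →₀ K) → Prop} (w : ι →₀ K) (zero : P 0)
    (add : ∀ u v, P u → P v → P (u + v)) (smul : ∀ (a : K) u, P u → P (a • u))
    (basis : ∀ u : ι, P (Finsupp.single u 1)) : P w := by
  induction w using Finsupp.induction_linear with
  | zero => exact zero
  | add u v hu hv => exact add u v hu hv
  | single u a =>
    have := smul a _ (basis u)
    rwa [Finsupp.smul_single, smul_eq_mul, mul_one] at this

theorem cons_single_single (x : X) (w : List X) (a b : K) :
    cons K X (Finsupp.single x a) (Finsupp.single w b) = Finsupp.single (x :: w) (a * b) := by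
  simp [cons, Finsupp.linearCombination_single, Finsupp.mapDomain_single]

theorem single_cons (x : X) (w : List X) :
    (Finsupp.single (x :: w) 1 : TensorWords K X) =
      cons K X (Finsupp.single x 1) (Finsupp.single w 1) := by
  rw [cons_single_single, mul_one]

theorem shuffle_single_single (u v : List X) :
    shuffle K X (Finsupp.single u 1) (Finsupp.single v 1) = shuffleWord K u v := by
  simp [shuffle, Finsupp.linearCombination_single]

theorem preLie_single_single (f : (X →₀ K) →ₗ[K] (X →₀ K)) (u v : List X) :
    preLie f (Finsupp.single u 1) (Finsupp.single v 1) = preLieWord f u v := by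
  simp [preLie, Finsupp.linearCombination_single]

@[simp]
theorem nil_shuffle (w : TensorWords K X) : shuffle K X (Finsupp.single [] 1) w = w := by
  induction w using induction_basis with
  | zero => simp
  | add u v hu hv => rw [map_add, hu, hv]
  | smul a u hu => rw [map_smul, hu]
  | basis u => rw [shuffle_single_single, shuffleWord]

@[simp]
theorem shuffle_nil (w : TensorWords K X) : shuffle K X w (Finsupp.single [] 1) = w := by
  induction w using induction_basis with
  | zero => simp
  | add u v hu hv => rw [map_add, LinearMap.add_apply, hu, hv]
  | smul a u hu => rw [map_smul, LinearMap.smul_apply, hu]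
  | basis u => cases u <;> rw [shuffle_single_single, shuffleWord]

/-- The recursion on words is multilinear, so it holds with arbitrary vectors as heads and arbitrary
tensors as tails. This allows inductions that never expand the tails into words. -/
theorem cons_shuffle_cons (a b : X →₀ K) (u v : TensorWords K X) :
    shuffle K X (cons K X a u) (cons K X b v) =
      cons K X a (shuffle K X u (cons K X b v)) + cons K X b (shuffle K X (cons K X a u) v) := by
  induction a using induction_basis with
  | zero => simp
  | add a a' h h' => simp only [map_add, LinearMap.add_apply, h, h']; abel
  | smul c a h => simp only [map_smul, LinearMap.smul_apply, h, smul_add]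
  | basis x =>
  induction b using induction_basis with
  | zero => simp
  | add b b' h h' => simp only [map_add, LinearMap.add_apply, h, h']; abel
  | smul c b h => simp only [map_smul, LinearMap.smul_apply, h, smul_add]
  | basis y =>
  induction u using induction_basis with
  | zero => simp
  | add u u' h h' => simp only [map_add, LinearMap.add_apply, h, h']; abel
  | smul c u h => simp only [map_smul, LinearMap.smul_apply, h, smul_add]
  | basis u =>
  induction v using induction_basis with
  | zero => simp
  | add v v' h h' => simp only [map_add, h, h']; abel
  | smul c v h => simp only [map_smul, h, smul_add]
  | basis v => simp only [← single_cons, shuffle_single_single, shuffleWord]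

theorem nil_preLie (f : (X →₀ K) →ₗ[K] (X →₀ K)) (w : TensorWords K X) :
    preLie f (Finsupp.single [] 1) w = 0 := by
  induction w using induction_basis with
  | zero => simp
  | add u v hu hv => rw [map_add, hu, hv, add_zero]
  | smul a u hu => rw [map_smul, hu, smul_zero]
  | basis u => rw [preLie_single_single, preLieWord]

theorem cons_preLie (f : (X →₀ K) →ₗ[K] (X →₀ K)) (a : X →₀ K) (u v : TensorWords K X) :
    preLie f (cons K X a u) v =
      cons K X a (preLie f u v) + cons K X (f a) (shuffle K X u v) := by
  induction a using induction_basis with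
  | zero => simp
  | add a a' h h' => simp only [map_add, LinearMap.add_apply, h, h']; abel
  | smul c a h => simp only [map_smul, LinearMap.smul_apply, h, smul_add]
  | basis x =>
  induction u using induction_basis with
  | zero => simp
  | add u u' h h' => simp only [map_add, LinearMap.add_apply, h, h']; abel
  | smul c u h => simp only [map_smul, LinearMap.smul_apply, h, smul_add]
  | basis u =>
  induction v using induction_basis with
  | zero => simp
  | add v v' h h' => simp only [map_add, h, h']; abel
  | smul c v h => simp only [map_smul, h, smul_add]
  | basis v =>
    simp only [← single_cons, shuffle_single_single, preLie_single_single, preLieWord]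

theorem shuffle_comm (u v : TensorWords K X) : shuffle K X u v = shuffle K X v u := by
  induction u using induction_basis with
  | zero => simp
  | add u u' h h' => simp only [map_add, LinearMap.add_apply, h, h']
  | smul c u h => simp only [map_smul, LinearMap.smul_apply, h]
  | basis u =>
  induction v using induction_basis with
  | zero => simp
  | add v v' h h' => simp only [map_add, LinearMap.add_apply, h, h']
  | smul c v h => simp only [map_smul, LinearMap.smul_apply, h]
  | basis v =>
  induction u generalizing v with
  | nil => simp
  | cons x u ihu =>
    induction v with
    | nil => simp
    | cons y v ihv =>
      rw [single_cons x, single_cons y, cons_shuffle_cons, cons_shuffle_cons, ← single_cons x,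
        ← single_cons y, ihv, ihu, add_comm]

theorem shuffle_assoc (u v w : TensorWords K X) :
    shuffle K X (shuffle K X u v) w = shuffle K X u (shuffle K X v w) := by
  induction u using induction_basis with
  | zero => simp
  | add u u' h h' => simp only [map_add, LinearMap.add_apply, h, h']
  | smul c u h => simp only [map_smul, LinearMap.smul_apply, h]
  | basis u =>
  induction v using induction_basis with
  | zero => simp
  | add v v' h h' => simp only [map_add, LinearMap.add_apply, h, h']
  | smul c v h => simp only [map_smul, LinearMap.smul_apply, h]
  | basis v =>
  induction w using induction_basis with
  | zero => simp
  | add v v' h h' => simp only [map_add, h, h']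
  | smul c v h => simp only [map_smul, h]
  | basis w =>
  induction u generalizing v w with
  | nil => simp
  | cons x u ihu =>
  induction v generalizing w with
  | nil => simp
  | cons y v ihv =>
  induction w with
  | nil => simp
  | cons z w ihw =>
    have hu := ihu (y :: v) (z :: w)
    have hv := ihv (z :: w)
    simp only [single_cons x, single_cons y, single_cons z, cons_shuffle_cons, map_add,
      LinearMap.add_apply] at hu hv ihw ⊢
    rw [hu, hv]
    -- The terms headed by `z` appear on the left split by the first letter of the inner shuffle;
    -- `ihw` is used backwards to split those on the right in the same way.
    simp only [map_add, ← ihw]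
    abel

theorem shuffle_left_comm (u v w : TensorWords K X) :
    shuffle K X u (shuffle K X v w) = shuffle K X v (shuffle K X u w) := by
  rw [← shuffle_assoc, shuffle_comm u, shuffle_assoc]

/-- Makes shuffle products over a multiset well defined as `Multiset.foldr`. -/
instance shuffle_leftCommutative {R : Type*} (φ : R → TensorWords K X) :
    LeftCommutative fun r w => shuffle K X (φ r) w :=
  ⟨fun _ _ _ => shuffle_left_comm _ _ _⟩

/-- The Leibniz rule of a Com-Pre-Lie algebra: `• w` alters one letter of a word and shuffles `w`
into what follows it, and each letter of a shuffle comes from exactly one of the two factors. -/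
theorem shuffle_preLie (f : (X →₀ K) →ₗ[K] (X →₀ K)) (u v w : TensorWords K X) :
    preLie f (shuffle K X u v) w =
      shuffle K X (preLie f u w) v + shuffle K X u (preLie f v w) := by
  induction u using induction_basis with
  | zero => simp
  | add u u' h h' => simp only [map_add, LinearMap.add_apply, h, h']; abel
  | smul c u h => simp only [map_smul, LinearMap.smul_apply, h, smul_add]
  | basis u =>
  induction v using induction_basis with
  | zero => simp
  | add v v' h h' => simp only [map_add, LinearMap.add_apply, h, h']; abel
  | smul c v h => simp only [map_smul, LinearMap.smul_apply, h, smul_add]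
  | basis v =>
  induction u generalizing v with
  | nil => simp [nil_preLie]
  | cons x u ihu =>
  induction v with
  | nil => simp [nil_preLie]
  | cons y v ihv =>
    have hu := ihu (y :: v)
    rw [single_cons] at hu
    rw [single_cons] at ihv
    -- The term headed by `f(x)` carries `w` last on one side and next to `u` on the other.
    have e₁ : ∀ b, shuffle K X (shuffle K X (Finsupp.single u 1) b) w =
        shuffle K X (shuffle K X (Finsupp.single u 1) w) b := fun b => by
      rw [shuffle_assoc, shuffle_comm b, shuffle_assoc]
    simp only [single_cons x, single_cons y, cons_shuffle_cons, cons_preLie, map_add,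
      LinearMap.add_apply, hu, ihv, e₁, ← shuffle_assoc]
    abel

-- Erasing the first letter

/-- The projection of a word to its tail if its first letter is `x`, and to zero otherwise. -/
noncomputable def headDeriv (K : Type v) [Field K] {X : Type w} (x : X) :
    TensorWords K X →ₗ[K] TensorWords K X :=
  Finsupp.lcomapDomain (List.cons x) (List.cons_injective)

theorem headDeriv_nil (x : X) : headDeriv K x (Finsupp.single [] 1) = 0 := by
  ext w
  simp [headDeriv, Finsupp.lcomapDomain]

open Classical in
theorem headDeriv_cons (x y : X) (w : TensorWords K X) :
    headDeriv K x (cons K X (Finsupp.single y 1) w) = if x = y then w else 0 := by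
  induction w using induction_basis with
  | zero => simp
  | add u v hu hv => rw [map_add, map_add, hu, hv]; split_ifs <;> simp
  | smul a u hu => rw [map_smul, map_smul, hu]; split_ifs <;> simp
  | basis u =>
    rw [← single_cons]
    ext w
    simp only [headDeriv, Finsupp.lcomapDomain, LinearMap.coe_mk, AddHom.coe_mk,
      Finsupp.comapDomain_apply]
    split_ifs with h <;> simp [Finsupp.single_apply, h, eq_comm]

/-- The first letter of a shuffle of two words is the first letter of one of them, the other word
being still intact. -/
theorem headDeriv_shuffle (x : X) (u v : TensorWords K X) :
    headDeriv K x (shuffle K X u v) =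
      shuffle K X (headDeriv K x u) v + shuffle K X u (headDeriv K x v) := by
  induction u using induction_basis with
  | zero => simp
  | add u u' h h' => simp only [map_add, LinearMap.add_apply, h, h']; abel
  | smul c u h => simp only [map_smul, LinearMap.smul_apply, h, smul_add]
  | basis u =>
  induction v using induction_basis with
  | zero => simp
  | add v v' h h' => simp only [map_add, h, h']; abel
  | smul c v h => simp only [map_smul, h, smul_add]
  | basis v =>
  cases u with
  | nil => simp [headDeriv_nil]
  | cons y u =>
  cases v with
  | nil => simp [headDeriv_nil]
  | cons z v =>
    rw [single_cons y, single_cons z, cons_shuffle_cons, map_add]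
    simp only [headDeriv_cons]
    split_ifs <;> simp

end TensorWords

open TensorWords

theorem LinearMap.map_multiset_sum_map {ι R M N : Type*} [Semiring R] [AddCommMonoid M]
    [AddCommMonoid N] [Module R M] [Module R N] (f : M →ₗ[R] N) (s : Multiset ι) (g : ι → M) :
    f (s.map g).sum = (s.map fun i => f (g i)).sum := by
  rw [map_multiset_sum, Multiset.map_map]
  rfl

theorem LinearMap.map_multiset_sum_map₂ {ι R M N P : Type*} [CommSemiring R] [AddCommMonoid M]
    [AddCommMonoid N] [AddCommMonoid P] [Module R M] [Module R N] [Module R P]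
    (f : M →ₗ[R] N →ₗ[R] P) (s : Multiset ι) (g : ι → M) (y : N) :
    f (s.map g).sum y = (s.map fun i => f (g i) y).sum :=
  LinearMap.map_multiset_sum_map (f.flip y) s g

/-! ### Partitioned trees as nested multisets -/

/-- The multiset of the blocks of a list. -/
def PlanarBlocks.blocks {D : Type u} : PlanarBlocks D → Multiset (PartTree D)
  | .nil => 0
  | .cons b F => PartTree.mk b ::ₘ F.blocks

theorem PlanarBlocks.Iso.blocks_eq {D : Type u} {F F' : PlanarBlocks D} (h : F.Iso F') :
    F.blocks = F'.blocks :=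
  match h with
  | .refl _ => rfl
  | .symm h => h.blocks_eq.symm
  | .trans h h' => h.blocks_eq.trans h'.blocks_eq
  | .cons (b := b) (b' := b') h h' => by
      have e : PartTree.mk b = PartTree.mk b' := Quotient.sound h
      rw [PlanarBlocks.blocks, PlanarBlocks.blocks, e, h'.blocks_eq]
  | .swap b b' F => Multiset.cons_swap _ _ _

instance PartTree.consBlock_leftCommutative {D : Type u} :
    LeftCommutative (PartTree.consBlock (D := D)) :=
  ⟨PartTree.consBlock_comm⟩

/-- The class of the lists of blocks with given multiset of blocks. -/
def PartTree.ofBlocks {D : Type u} (c : Multiset (PartTree D)) : Quotient (PlanarBlocks.setoid D) :=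
  c.foldr PartTree.consBlock (Quotient.mk _ .nil)

theorem PartTree.ofBlocks_blocks {D : Type u} :
    (F : PlanarBlocks D) → PartTree.ofBlocks F.blocks = Quotient.mk _ F
  | .nil => rfl
  | .cons b F => by
      rw [PlanarBlocks.blocks, ofBlocks, Multiset.foldr_cons, ← ofBlocks, ofBlocks_blocks F]
      rfl

/-- A vertex together with the multiset of the blocks of its children. -/
abbrev PartTree.Vertex (D : Type u) : Type u := D × Multiset (PartTree D)

/-- The multiset of the vertices of a root block. -/
def PlanarBlock.roots {D : Type u} : PlanarBlock D → Multiset (PartTree.Vertex D)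
  | .single d c => {(d, c.blocks)}
  | .cons d c b => (d, c.blocks) ::ₘ b.roots

theorem PlanarBlock.Iso.roots_eq {D : Type u} {b b' : PlanarBlock D} (h : b.Iso b') :
    b.roots = b'.roots :=
  match h with
  | .refl _ => rfl
  | .symm h => h.roots_eq.symm
  | .trans h h' => h.roots_eq.trans h'.roots_eq
  | .single d h => by rw [PlanarBlock.roots, PlanarBlock.roots, h.blocks_eq]
  | .cons d h h' => by rw [PlanarBlock.roots, PlanarBlock.roots, h.blocks_eq, h'.roots_eq]
  | .swapLast d e c c' => by
      simp only [PlanarBlock.roots, ← Multiset.cons_zero]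
      exact Multiset.cons_swap _ _ _
  | .swap d e c c' b => Multiset.cons_swap _ _ _

/-- The multiset of the roots of a partitioned tree. -/
def PartTree.roots {D : Type u} : PartTree D → Multiset (PartTree.Vertex D) :=
  Quotient.lift PlanarBlock.roots fun _ _ h => h.roots_eq

theorem PlanarBlock.roots_merge {D : Type u} (a : PlanarBlock D) :
    (b : PlanarBlock D) → (b.merge a).roots = b.roots + a.roots
  | .single d c => by rw [PlanarBlock.merge, roots, roots, Multiset.singleton_add]
  | .cons d c b => by rw [PlanarBlock.merge, roots, roots, roots_merge a b, Multiset.cons_add]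

theorem PartTree.roots_merge {D : Type u} (t t' : PartTree D) :
    (t.merge t').roots = t.roots + t'.roots := by
  induction t using Quotient.inductionOn
  induction t' using Quotient.inductionOn
  exact PlanarBlock.roots_merge _ _

/-- Adding a vertex to a possibly empty root block. -/
def PartTree.addVertex {D : Type u} (r : PartTree.Vertex D) : Option (PartTree D) → PartTree D
  | none => PartTree.single r.1 (ofBlocks r.2)
  | some b => PartTree.cons r.1 (ofBlocks r.2) b

instance PartTree.addVertex_leftCommutative {D : Type u} :
    LeftCommutative fun (r : PartTree.Vertex D) b => some (PartTree.addVertex r b) where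
  left_comm r s b := by
    cases b with
    | none => exact congrArg some (cons_single_comm _ _ _ _)
    | some b => exact congrArg some (cons_cons_comm _ _ _ _ _)

theorem PlanarBlock.foldr_addVertex_roots {D : Type u} : (b : PlanarBlock D) →
    b.roots.foldr (fun r b => some (PartTree.addVertex r b)) none = some (PartTree.mk b)
  | .single d c => by
      rw [roots, Multiset.foldr_singleton, PartTree.addVertex, PartTree.ofBlocks_blocks]
      rfl
  | .cons d c b => by
      rw [roots, Multiset.foldr_cons, foldr_addVertex_roots b, PartTree.addVertex,
        PartTree.ofBlocks_blocks]
      rfl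

/-- The vertices can be reassembled into a root block by a fold, starting from `none` because a root
block is never empty. Partitioned trees may thus be replaced by multisets of vertices, among which
the empty forest exists. -/
theorem PartTree.roots_injective {D : Type u} :
    Function.Injective (PartTree.roots (D := D)) := by
  intro t t' h
  induction t using Quotient.inductionOn with | _ b
  induction t' using Quotient.inductionOn with | _ b'
  have h : b.roots = b'.roots := h
  have := b.foldr_addVertex_roots
  rw [h, b'.foldr_addVertex_roots] at this
  exact (Option.some.inj this).symm

noncomputable section

/-! ### The biword of a partitioned tree -/

mutual
/-- The image of a planar partitioned tree in `T(V_D, f_D)`. -/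
def PlanarBlock.biword (K : Type v) [Field K] {D : Type u} : PlanarBlock D → Biwords K D
  | .single d c => cons K _ (Finsupp.single (Multiset.card c.blocks, d) 1) (c.biword K)
  | .cons d c b => shuffle K _
      (cons K _ (Finsupp.single (Multiset.card c.blocks, d) 1) (c.biword K)) (b.biword K)
/-- The shuffle product of the images of the blocks of a list. -/
def PlanarBlocks.biword (K : Type v) [Field K] {D : Type u} : PlanarBlocks D → Biwords K D
  | .nil => Finsupp.single [] 1
  | .cons b F => shuffle K _ (b.biword K) (F.biword K)
end

mutual
theorem PlanarBlock.Iso.biword_eq (K : Type v) [Field K] {D : Type u} :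
    {b b' : PlanarBlock D} → b.Iso b' → b.biword K = b'.biword K
  | _, _, .refl _ => rfl
  | _, _, .symm h => (PlanarBlock.Iso.biword_eq K h).symm
  | _, _, .trans h h' => (PlanarBlock.Iso.biword_eq K h).trans (PlanarBlock.Iso.biword_eq K h')
  | _, _, .single d h => by
      rw [PlanarBlock.biword, PlanarBlock.biword, h.blocks_eq, PlanarBlocks.Iso.biword_eq K h]
  | _, _, .cons d h h' => by
      rw [PlanarBlock.biword, PlanarBlock.biword, h.blocks_eq, PlanarBlocks.Iso.biword_eq K h,
        PlanarBlock.Iso.biword_eq K h']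
  | _, _, .swapLast d e c c' => by
      simp only [PlanarBlock.biword]
      exact shuffle_comm _ _
  | _, _, .swap d e c c' b => by
      simp only [PlanarBlock.biword]
      exact shuffle_left_comm _ _ _
theorem PlanarBlocks.Iso.biword_eq (K : Type v) [Field K] {D : Type u} :
    {F F' : PlanarBlocks D} → F.Iso F' → F.biword K = F'.biword K
  | _, _, .refl _ => rfl
  | _, _, .symm h => (PlanarBlocks.Iso.biword_eq K h).symm
  | _, _, .trans h h' => (PlanarBlocks.Iso.biword_eq K h).trans (PlanarBlocks.Iso.biword_eq K h')
  | _, _, .cons h h' => by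
      rw [PlanarBlocks.biword, PlanarBlocks.biword, PlanarBlock.Iso.biword_eq K h,
        PlanarBlocks.Iso.biword_eq K h']
  | _, _, .swap b b' F => by
      simp only [PlanarBlocks.biword]
      exact shuffle_left_comm _ _ _
end

/-- The image of a partitioned tree in `T(V_D, f_D)`. -/
def PartTree.biword (K : Type v) [Field K] {D : Type u} : PartTree D → Biwords K D :=
  Quotient.lift (PlanarBlock.biword K) fun _ _ h => h.biword_eq K

theorem PlanarBlock.biword_merge (K : Type v) [Field K] {D : Type u} (a : PlanarBlock D) :
    (b : PlanarBlock D) → (b.merge a).biword K = shuffle K _ (b.biword K) (a.biword K)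
  | .single d c => by simp only [PlanarBlock.merge, biword]
  | .cons d c b => by simp only [PlanarBlock.merge, biword, biword_merge K a b, shuffle_assoc]

/-- Grafting above a vertex of one of the blocks enlarges that block without creating a new one in
the list. The letter of the parent vertex is therefore unchanged. -/
theorem PlanarBlocks.card_blocks_graft {D : Type u} (t : PlanarBlock D) :
    (F : PlanarBlocks D) → ∀ F' ∈ PlanarBlocks.graft t F,
      Multiset.card F'.blocks = Multiset.card F.blocks
  | .nil, _, h => by simp [PlanarBlocks.graft] at h
  | .cons b F, _, h => by
      simp only [PlanarBlocks.graft, Multiset.mem_add, Multiset.mem_map] at h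
      obtain ⟨b', _, rfl⟩ | ⟨F', hF', rfl⟩ := h
      · simp [blocks]
      · simp [blocks, card_blocks_graft t F F' hF']

theorem biletterShift_single {K : Type v} [Field K] {D : Type u} (k : ℕ) (d : D) :
    biletterShift K D (Finsupp.single (k, d) 1) = Finsupp.single (k + 1, d) 1 := by
  simp [biletterShift, Finsupp.mapDomain_single]

mutual
theorem PlanarBlock.sum_biword_graft (K : Type v) [Field K] {D : Type u} (t : PlanarBlock D) :
    (b : PlanarBlock D) → ((PlanarBlock.graft t b).map (PlanarBlock.biword K)).sum =
      preLie (biletterShift K D) (b.biword K) (t.biword K)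
  | .single d c => by
      have h := PlanarBlocks.sum_biword_root_graft K t d c
      simp only [PlanarBlock.graft, Multiset.map_add, Multiset.map_map, Multiset.map_singleton,
        Multiset.sum_add, Multiset.sum_singleton, PlanarBlock.biword, Function.comp_def]
      exact h
  | .cons d c b => by
      have h := PlanarBlocks.sum_biword_root_graft K t d c
      simp only [PlanarBlock.graft, Multiset.map_add, Multiset.map_map, Multiset.map_singleton,
        Multiset.sum_add, Multiset.sum_singleton, PlanarBlock.biword, Function.comp_def]
      rw [shuffle_preLie, ← h, ← PlanarBlock.sum_biword_graft K t b, map_add, LinearMap.add_apply,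
        LinearMap.map_multiset_sum_map₂, LinearMap.map_multiset_sum_map]
-- The first summand is the grafting on the root itself, the sum collects the graftings higher up;
-- they match the two terms in the recursive definition of `•`.
theorem PlanarBlocks.sum_biword_root_graft (K : Type v) [Field K] {D : Type u} (t : PlanarBlock D)
    (d : D) : (c : PlanarBlocks D) →
      cons K _ (Finsupp.single (Multiset.card (PlanarBlocks.cons t c).blocks, d) 1)
          ((PlanarBlocks.cons t c).biword K) +
        ((PlanarBlocks.graft t c).map fun c' =>
          cons K _ (Finsupp.single (Multiset.card c'.blocks, d) 1) (c'.biword K)).sum =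
      preLie (biletterShift K D)
        (cons K _ (Finsupp.single (Multiset.card c.blocks, d) 1) (c.biword K)) (t.biword K)
  | c => by
      rw [cons_preLie, ← PlanarBlocks.sum_biword_graft K t c, biletterShift_single,
        PlanarBlocks.blocks, Multiset.card_cons, PlanarBlocks.biword, shuffle_comm, add_comm,
        map_multiset_sum, Multiset.map_map]
      congr 2
      refine Multiset.map_congr rfl fun c' hc' => ?_
      rw [PlanarBlocks.card_blocks_graft t c c' hc', Function.comp_apply]
theorem PlanarBlocks.sum_biword_graft (K : Type v) [Field K] {D : Type u} (t : PlanarBlock D) :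
    (F : PlanarBlocks D) → ((PlanarBlocks.graft t F).map (PlanarBlocks.biword K)).sum =
      preLie (biletterShift K D) (F.biword K) (t.biword K)
  | .nil => by simp [PlanarBlocks.graft, PlanarBlocks.biword, nil_preLie]
  | .cons b F => by
      simp only [PlanarBlocks.graft, Multiset.map_add, Multiset.map_map,
        Multiset.sum_add, PlanarBlocks.biword, Function.comp_def]
      rw [shuffle_preLie, ← PlanarBlock.sum_biword_graft K t b,
        ← PlanarBlocks.sum_biword_graft K t F,
        LinearMap.map_multiset_sum_map₂, LinearMap.map_multiset_sum_map]
end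

-- Existence of the morphism

/-- The Com-Pre-Lie morphism from partitioned trees to biwords. -/
def ComPrelie.toBiwords (K : Type v) [Field K] (D : Type u) : ComPrelie K D →ₗ[K] Biwords K D :=
  Finsupp.linearCombination K (PartTree.biword K)

theorem ComPrelie.toBiwords_single {K : Type v} [Field K] {D : Type u} (t : PartTree D) :
    toBiwords K D (Finsupp.single t 1) = t.biword K := by
  simp [toBiwords, Finsupp.linearCombination_single]

theorem ComPrelie.shuffle_single_single {K : Type v} [Field K] {D : Type u} (t t' : PartTree D) :
    ComPrelie.shuffle K D (Finsupp.single t 1) (Finsupp.single t' 1) =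
      Finsupp.single (t.merge t') 1 := by
  simp [ComPrelie.shuffle, Finsupp.linearCombination_single]

theorem ComPrelie.preLie_single_single {K : Type v} [Field K] {D : Type u} (t t' : PartTree D) :
    ComPrelie.preLie K D (Finsupp.single t 1) (Finsupp.single t' 1) =
      ((t.graft t').map fun s => Finsupp.single s (1 : K)).sum := by
  simp [ComPrelie.preLie, Finsupp.linearCombination_single]

theorem ComPrelie.isPhiCPL_toBiwords (K : Type v) [Field K] (D : Type u) :
    IsPhiCPL (ComPrelie.toBiwords K D) where
  map_shuffle x y := by
    induction x using induction_basis with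
    | zero => simp
    | add u u' h h' => simp only [map_add, LinearMap.add_apply, h, h']
    | smul c u h => simp only [map_smul, LinearMap.smul_apply, h]
    | basis t =>
    induction y using induction_basis with
    | zero => simp
    | add u u' h h' => simp only [map_add, h, h']
    | smul c u h => simp only [map_smul, h]
    | basis t' =>
    rw [ComPrelie.shuffle_single_single, toBiwords_single, toBiwords_single, toBiwords_single]
    induction t using Quotient.inductionOn
    induction t' using Quotient.inductionOn
    exact PlanarBlock.biword_merge K _ _
  map_preLie x y := by
    induction x using induction_basis with
    | zero => simp
    | add u u' h h' => simp only [map_add, LinearMap.add_apply, h, h']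
    | smul c u h => simp only [map_smul, LinearMap.smul_apply, h]
    | basis t =>
    induction y using induction_basis with
    | zero => simp
    | add u u' h h' => simp only [map_add, h, h']
    | smul c u h => simp only [map_smul, h]
    | basis t' =>
    rw [ComPrelie.preLie_single_single, toBiwords_single, toBiwords_single, map_multiset_sum,
      Multiset.map_map]
    simp only [Function.comp_def, toBiwords_single]
    induction t using Quotient.inductionOn with | _ b
    induction t' using Quotient.inductionOn with | _ b'
    refine Eq.trans ?_ (PlanarBlock.sum_biword_graft K b' b)
    exact congrArg _ (Multiset.map_map _ _ _)
  map_dot d := by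
    rw [ComPrelie.dot, toBiwords_single]
    change cons K _ _ _ = _
    rw [PlanarBlocks.biword, cons_single_single, mul_one]
    rfl

end

noncomputable section

/-! ### Generation by the one-vertex trees -/

/-- The classes of the graftings of a partitioned tree on the vertices of a list of blocks. -/
def PartTree.graftBlocks {D : Type u} :
    Quotient (PlanarBlocks.setoid D) → PartTree D → Multiset (Quotient (PlanarBlocks.setoid D)) :=
  Quotient.lift₂ (fun F t => PlanarBlocks.graftClass t F) fun _ _ _ t' h h' =>
    (PlanarBlocks.graftClass_congr_left h' _).trans (PlanarBlocks.graftClass_congr_right t' h)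

/-- The space with basis the isomorphism classes of lists of blocks. -/
abbrev BlocksModule (K : Type v) [Field K] (D : Type u) : Type (max u v) :=
  Quotient (PlanarBlocks.setoid D) →₀ K

namespace BlocksModule

variable {K : Type v} [Field K] {D : Type u}

/-- Addition of a block. -/
def consBlock (K : Type v) [Field K] (D : Type u) :
    ComPrelie K D →ₗ[K] BlocksModule K D →ₗ[K] BlocksModule K D :=
  Finsupp.linearCombination K fun t => Finsupp.lmapDomain K K (PartTree.consBlock t)

/-- Grafting on the vertices of a list of blocks. -/
def preLie (K : Type v) [Field K] (D : Type u) :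
    BlocksModule K D →ₗ[K] ComPrelie K D →ₗ[K] BlocksModule K D :=
  Finsupp.linearCombination K fun F =>
    Finsupp.linearCombination K fun t =>
      ((PartTree.graftBlocks F t).map fun s => Finsupp.single s (1 : K)).sum

/-- Grafting of the blocks on a common root. -/
def addRoot (K : Type v) [Field K] {D : Type u} (d : D) : BlocksModule K D →ₗ[K] ComPrelie K D :=
  Finsupp.lmapDomain K K (PartTree.single d)

theorem consBlock_single_single (t : PartTree D) (F : Quotient (PlanarBlocks.setoid D)) :
    consBlock K D (Finsupp.single t 1) (Finsupp.single F 1) =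
      Finsupp.single (PartTree.consBlock t F) 1 := by
  simp [consBlock, Finsupp.linearCombination_single, Finsupp.mapDomain_single]

theorem preLie_single_single (t : PartTree D) (F : Quotient (PlanarBlocks.setoid D)) :
    preLie K D (Finsupp.single F 1) (Finsupp.single t 1) =
      ((PartTree.graftBlocks F t).map fun s => Finsupp.single s (1 : K)).sum := by
  simp [preLie, Finsupp.linearCombination_single]

theorem addRoot_single (d : D) (F : Quotient (PlanarBlocks.setoid D)) :
    addRoot K d (Finsupp.single F 1) = Finsupp.single (PartTree.single d F) 1 := by
  simp [addRoot, Finsupp.mapDomain_single]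

/-- The vertex on which `x` is grafted is either the new root or a vertex of `F`. -/
theorem addRoot_preLie (d : D) (F : BlocksModule K D) (x : ComPrelie K D) :
    ComPrelie.preLie K D (addRoot K d F) x =
      addRoot K d (consBlock K D x F) + addRoot K d (preLie K D F x) := by
  induction F using induction_basis with
  | zero => simp
  | add u u' h h' => simp only [map_add, LinearMap.add_apply, h, h']; abel
  | smul c u h => simp only [map_smul, LinearMap.smul_apply, h, smul_add]
  | basis F =>
  induction x using induction_basis with
  | zero => simp
  | add u u' h h' => simp only [map_add, LinearMap.add_apply, h, h']; abel
  | smul c u h => simp only [map_smul, LinearMap.smul_apply, h, smul_add]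
  | basis t =>
  rw [consBlock_single_single, preLie_single_single, addRoot_single, addRoot_single,
    ComPrelie.preLie_single_single, LinearMap.map_multiset_sum_map]
  simp only [addRoot_single]
  induction F using Quotient.inductionOn with | _ F
  induction t using Quotient.inductionOn with | _ t
  refine (congrArg (fun s => (Multiset.map (fun s => Finsupp.single s (1 : K)) s).sum)
    (PlanarBlock.graftClass_single t d F)).trans ?_
  rw [Multiset.map_add, Multiset.sum_add, Multiset.map_singleton, Multiset.sum_singleton,
    Multiset.map_map]
  rfl

/-- Leibniz rule: the vertex on which `x` is grafted lies either in the block `y` or in `F`. -/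
theorem consBlock_preLie (y : ComPrelie K D) (F : BlocksModule K D) (x : ComPrelie K D) :
    preLie K D (consBlock K D y F) x =
      consBlock K D (ComPrelie.preLie K D y x) F + consBlock K D y (preLie K D F x) := by
  induction F using induction_basis with
  | zero => simp
  | add u u' h h' => simp only [map_add, LinearMap.add_apply, h, h']; abel
  | smul c u h => simp only [map_smul, LinearMap.smul_apply, h, smul_add]
  | basis F =>
  induction x using induction_basis with
  | zero => simp
  | add u u' h h' => simp only [map_add, LinearMap.add_apply, h, h']; abel
  | smul c u h => simp only [map_smul, LinearMap.smul_apply, h, smul_add]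
  | basis t =>
  induction y using induction_basis with
  | zero => simp
  | add u u' h h' => simp only [map_add, LinearMap.add_apply, h, h']; abel
  | smul c u h => simp only [map_smul, LinearMap.smul_apply, h, smul_add]
  | basis b =>
  rw [consBlock_single_single, preLie_single_single, preLie_single_single,
    ComPrelie.preLie_single_single, LinearMap.map_multiset_sum_map₂,
    LinearMap.map_multiset_sum_map]
  simp only [consBlock_single_single]
  induction F using Quotient.inductionOn with | _ F
  induction t using Quotient.inductionOn with | _ t
  induction b using Quotient.inductionOn with | _ b
  refine (congrArg (fun s => (Multiset.map (fun s => Finsupp.single s (1 : K)) s).sum)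
    (PlanarBlocks.graftClass_cons t b F)).trans ?_
  rw [Multiset.map_add, Multiset.sum_add, Multiset.map_map, Multiset.map_map]
  rfl

theorem nil_preLie (x : ComPrelie K D) :
    preLie K D (Finsupp.single (Quotient.mk _ .nil) 1) x = 0 := by
  induction x using induction_basis with
  | zero => simp
  | add u u' h h' => rw [map_add, h, h', add_zero]
  | smul c u h => rw [map_smul, h, smul_zero]
  | basis t =>
  rw [preLie_single_single]
  induction t using Quotient.inductionOn with | _ t
  rfl

/-- The products of `n` blocks taken from the subspace `S`. -/
def blockPower (S : Submodule K (ComPrelie K D)) : ℕ → Submodule K (BlocksModule K D)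
  | 0 => Submodule.span K {Finsupp.single (Quotient.mk _ .nil) 1}
  | n + 1 => Submodule.span K {G | ∃ x ∈ S, ∃ F ∈ blockPower S n, G = consBlock K D x F}

/-- By the Leibniz rule, grafting keeps the number of blocks. This is what lets the induction on `n`
in `addRoot_mem` apply to `F • y` as well as to `F`. -/
theorem preLie_mem_blockPower {S : Submodule K (ComPrelie K D)}
    (hS : ∀ x ∈ S, ∀ y ∈ S, ComPrelie.preLie K D x y ∈ S) {x : ComPrelie K D} (hx : x ∈ S)
    {n : ℕ} {F : BlocksModule K D} (hF : F ∈ blockPower S n) :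
    preLie K D F x ∈ blockPower S n := by
  induction n generalizing F with
  | zero =>
    obtain ⟨a, rfl⟩ := Submodule.mem_span_singleton.1 hF
    rw [map_smul, LinearMap.smul_apply, nil_preLie, smul_zero]
    exact Submodule.zero_mem _
  | succ n ih =>
    have hle : blockPower S (n + 1) ≤
        (blockPower S (n + 1)).comap ((preLie K D).flip x) := by
      refine Submodule.span_le.2 ?_
      rintro _ ⟨y, hy, F, hF, rfl⟩
      rw [SetLike.mem_coe, Submodule.mem_comap, LinearMap.flip_apply, consBlock_preLie]
      exact Submodule.add_mem _ (Submodule.subset_span ⟨_, hS y hy x hx, F, hF, rfl⟩)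
        (Submodule.subset_span ⟨y, hy, _, ih hF, rfl⟩)
    exact hle hF

theorem addRoot_mem {S : Submodule K (ComPrelie K D)} (hdot : ∀ d, ComPrelie.dot K d ∈ S)
    (hS : ∀ x ∈ S, ∀ y ∈ S, ComPrelie.preLie K D x y ∈ S) (d : D)
    {n : ℕ} {F : BlocksModule K D} (hF : F ∈ blockPower S n) : addRoot K d F ∈ S := by
  induction n generalizing F with
  | zero =>
    obtain ⟨a, rfl⟩ := Submodule.mem_span_singleton.1 hF
    rw [map_smul, addRoot_single]
    exact Submodule.smul_mem _ _ (hdot d)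
  | succ n ih =>
    have hle : blockPower S (n + 1) ≤ S.comap (addRoot K d) := by
      refine Submodule.span_le.2 ?_
      rintro _ ⟨y, hy, F, hF, rfl⟩
      -- `B_d(yF) = B_d(F) • y - B_d(F • y)`, with only `n` blocks under the root in both terms on
      -- the right.
      rw [SetLike.mem_coe, Submodule.mem_comap, eq_sub_of_add_eq (addRoot_preLie d F y).symm]
      exact Submodule.sub_mem _ (hS _ (ih hF) _ hy) (ih (preLie_mem_blockPower hS hy hF))
    exact hle hF

end BlocksModule

open BlocksModule

theorem ComPrelie.single_mk_single_mem {K : Type v} [Field K] {D : Type u}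
    {S : Submodule K (ComPrelie K D)} (hdot : ∀ d, ComPrelie.dot K d ∈ S)
    (hS : ∀ x ∈ S, ∀ y ∈ S, ComPrelie.preLie K D x y ∈ S) (d : D) {c : PlanarBlocks D} {n : ℕ}
    (hc : Finsupp.single (Quotient.mk _ c) 1 ∈ blockPower S n) :
    Finsupp.single (PartTree.mk (.single d c)) 1 ∈ S := by
  have := addRoot_mem hdot hS d hc
  rwa [addRoot_single] at this

theorem BlocksModule.single_mk_cons_mem {K : Type v} [Field K] {D : Type u}
    {S : Submodule K (ComPrelie K D)} {b : PlanarBlock D} {F : PlanarBlocks D} {n : ℕ}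
    (hb : Finsupp.single (PartTree.mk b) 1 ∈ S)
    (hF : Finsupp.single (Quotient.mk _ F) 1 ∈ blockPower S n) :
    Finsupp.single (Quotient.mk _ (.cons b F)) 1 ∈ blockPower S (n + 1) :=
  Submodule.subset_span ⟨_, hb, _, hF,
    (consBlock_single_single (PartTree.mk b) (Quotient.mk _ F)).symm⟩

mutual
theorem PlanarBlock.IsRootedTree.single_mem {K : Type v} [Field K] {D : Type u}
    {S : Submodule K (ComPrelie K D)} (hdot : ∀ d, ComPrelie.dot K d ∈ S)
    (hS : ∀ x ∈ S, ∀ y ∈ S, ComPrelie.preLie K D x y ∈ S) :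
    (b : PlanarBlock D) → b.IsRootedTree → Finsupp.single (PartTree.mk b) 1 ∈ S
  | .single d c, hb =>
      (PlanarBlocks.AreRootedTrees.single_mem hdot hS c hb).elim fun _ h =>
        ComPrelie.single_mk_single_mem hdot hS d h
  | .cons _ _ _, hb => hb.elim
theorem PlanarBlocks.AreRootedTrees.single_mem {K : Type v} [Field K] {D : Type u}
    {S : Submodule K (ComPrelie K D)} (hdot : ∀ d, ComPrelie.dot K d ∈ S)
    (hS : ∀ x ∈ S, ∀ y ∈ S, ComPrelie.preLie K D x y ∈ S) :
    (F : PlanarBlocks D) → F.AreRootedTrees →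
      ∃ n, Finsupp.single (Quotient.mk _ F) 1 ∈ blockPower S n
  | .nil, _ => ⟨0, Submodule.subset_span rfl⟩
  | .cons b F, hF =>
      (PlanarBlocks.AreRootedTrees.single_mem hdot hS F hF.2).elim fun n h =>
        ⟨n + 1, single_mk_cons_mem (PlanarBlock.IsRootedTree.single_mem hdot hS b hF.1) h⟩
end

mutual
theorem PlanarBlock.single_mem {K : Type v} [Field K] {D : Type u}
    {S : Submodule K (ComPrelie K D)} (hdot : ∀ d, ComPrelie.dot K d ∈ S)
    (hS : ∀ x ∈ S, ∀ y ∈ S, ComPrelie.preLie K D x y ∈ S)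
    (hS' : ∀ x ∈ S, ∀ y ∈ S, ComPrelie.shuffle K D x y ∈ S) :
    (b : PlanarBlock D) → Finsupp.single (PartTree.mk b) 1 ∈ S
  | .single d c =>
      (PlanarBlocks.single_mem hdot hS hS' c).elim fun _ h =>
        ComPrelie.single_mk_single_mem hdot hS d h
  | .cons d c b => by
      obtain ⟨_, h⟩ := PlanarBlocks.single_mem hdot hS hS' c
      have := hS' _ (ComPrelie.single_mk_single_mem hdot hS d h) _
        (PlanarBlock.single_mem hdot hS hS' b)
      rwa [ComPrelie.shuffle_single_single] at this
theorem PlanarBlocks.single_mem {K : Type v} [Field K] {D : Type u}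
    {S : Submodule K (ComPrelie K D)} (hdot : ∀ d, ComPrelie.dot K d ∈ S)
    (hS : ∀ x ∈ S, ∀ y ∈ S, ComPrelie.preLie K D x y ∈ S)
    (hS' : ∀ x ∈ S, ∀ y ∈ S, ComPrelie.shuffle K D x y ∈ S) :
    (F : PlanarBlocks D) → ∃ n, Finsupp.single (Quotient.mk _ F) 1 ∈ blockPower S n
  | .nil => ⟨0, Submodule.subset_span rfl⟩
  | .cons b F =>
      (PlanarBlocks.single_mem hdot hS hS' F).elim fun n h =>
        ⟨n + 1, single_mk_cons_mem (PlanarBlock.single_mem hdot hS hS' b) h⟩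
end

theorem Prelie.le_of_preLie_closed {K : Type v} [Field K] {D : Type u}
    {S : Submodule K (ComPrelie K D)} (hdot : ∀ d, ComPrelie.dot K d ∈ S)
    (hS : ∀ x ∈ S, ∀ y ∈ S, ComPrelie.preLie K D x y ∈ S) : Prelie K D ≤ S := by
  refine Submodule.span_le.2 ?_
  rintro _ ⟨_, ⟨b, hb, rfl⟩, rfl⟩
  exact hb.single_mem hdot hS b

theorem ComPrelie.eq_top_of_closed {K : Type v} [Field K] {D : Type u}
    {S : Submodule K (ComPrelie K D)} (hdot : ∀ d, ComPrelie.dot K d ∈ S)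
    (hS : ∀ x ∈ S, ∀ y ∈ S, ComPrelie.preLie K D x y ∈ S)
    (hS' : ∀ x ∈ S, ∀ y ∈ S, ComPrelie.shuffle K D x y ∈ S) : S = ⊤ := by
  refine Submodule.eq_top_iff'.2 fun x => ?_
  induction x using induction_basis with
  | zero => exact S.zero_mem
  | add u v hu hv => exact S.add_mem hu hv
  | smul a u hu => exact S.smul_mem a hu
  | basis t =>
    induction t using Quotient.inductionOn with | _ b
    exact b.single_mem hdot hS hS'

-- Uniqueness of the two morphisms

theorem IsPhiCPL.ext {K : Type v} [Field K] {D : Type u} {Φ Ψ : ComPrelie K D →ₗ[K] Biwords K D}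
    (hΦ : IsPhiCPL Φ) (hΨ : IsPhiCPL Ψ) : Φ = Ψ := by
  refine LinearMap.eqLocus_eq_top.1 (ComPrelie.eq_top_of_closed (fun d => ?_)
    (fun x hx y hy => ?_) fun x hx y hy => ?_)
  · exact (hΦ.map_dot d).trans (hΨ.map_dot d).symm
  · rw [LinearMap.mem_eqLocus] at *
    rw [hΦ.map_preLie, hΨ.map_preLie, hx, hy]
  · rw [LinearMap.mem_eqLocus] at *
    rw [hΦ.map_shuffle, hΨ.map_shuffle, hx, hy]

theorem IsPhiPL.ext {K : Type v} [Field K] {D : Type u} {φ ψ : Prelie K D →ₗ[K] Biwords K D}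
    (hφ : IsPhiPL φ) (hψ : IsPhiPL ψ) : φ = ψ := by
  -- The locus of equality lives in `Prelie K D`; it is pushed into `ComPrelie K D`, where
  -- generation by the one-vertex trees is stated.
  have hle : Prelie K D ≤ (LinearMap.eqLocus φ ψ).map (Prelie K D).subtype := by
    refine Prelie.le_of_preLie_closed (fun d => ?_) ?_
    · exact ⟨Prelie.dot K d, (hφ.map_dot d).trans (hψ.map_dot d).symm, rfl⟩
    · rintro _ ⟨x, hx, rfl⟩ _ ⟨y, hy, rfl⟩
      refine ⟨Prelie.preLie x y, ?_, rfl⟩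
      rw [SetLike.mem_coe, LinearMap.mem_eqLocus] at *
      rw [hφ.map_preLie, hψ.map_preLie, hx, hy]
  ext1 x
  obtain ⟨y, hy, hyx⟩ := hle x.2
  rw [← Subtype.ext hyx]
  exact hy

theorem IsPhiCPL.domRestrict {K : Type v} [Field K] {D : Type u}
    {Φ : ComPrelie K D →ₗ[K] Biwords K D} (hΦ : IsPhiCPL Φ) :
    IsPhiPL (Φ.domRestrict (Prelie K D)) where
  map_preLie x y := hΦ.map_preLie x y
  map_dot d := hΦ.map_dot d

end

/-! ### The number of vertices -/

mutual
/-- The number of vertices of a planar partitioned tree. -/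
def PlanarBlock.size {D : Type u} : PlanarBlock D → ℕ
  | .single _ c => 1 + c.size
  | .cons _ c b => 1 + c.size + b.size
/-- The number of vertices of a list of blocks. -/
def PlanarBlocks.size {D : Type u} : PlanarBlocks D → ℕ
  | .nil => 0
  | .cons b F => b.size + F.size
end

mutual
theorem PlanarBlock.Iso.size_eq {D : Type u} :
    {b b' : PlanarBlock D} → b.Iso b' → b.size = b'.size
  | _, _, .refl _ => rfl
  | _, _, .symm h => (PlanarBlock.Iso.size_eq h).symm
  | _, _, .trans h h' => (PlanarBlock.Iso.size_eq h).trans (PlanarBlock.Iso.size_eq h')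
  | _, _, .single d h => by
      rw [PlanarBlock.size, PlanarBlock.size, PlanarBlocks.Iso.size_eq h]
  | _, _, .cons d h h' => by
      rw [PlanarBlock.size, PlanarBlock.size, PlanarBlocks.Iso.size_eq h,
        PlanarBlock.Iso.size_eq h']
  | _, _, .swapLast d e c c' => by simp only [PlanarBlock.size]; omega
  | _, _, .swap d e c c' b => by simp only [PlanarBlock.size]; omega
theorem PlanarBlocks.Iso.size_eq {D : Type u} :
    {F F' : PlanarBlocks D} → F.Iso F' → F.size = F'.size
  | _, _, .refl _ => rfl
  | _, _, .symm h => (PlanarBlocks.Iso.size_eq h).symm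
  | _, _, .trans h h' => (PlanarBlocks.Iso.size_eq h).trans (PlanarBlocks.Iso.size_eq h')
  | _, _, .cons h h' => by
      rw [PlanarBlocks.size, PlanarBlocks.size, PlanarBlock.Iso.size_eq h,
        PlanarBlocks.Iso.size_eq h']
  | _, _, .swap b b' F => by simp only [PlanarBlocks.size]; omega
end

/-- The number of vertices of a partitioned tree. -/
def PartTree.size {D : Type u} : PartTree D → ℕ :=
  Quotient.lift PlanarBlock.size fun _ _ h => h.size_eq

theorem PlanarBlocks.sum_size_blocks {D : Type u} :
    (F : PlanarBlocks D) → (F.blocks.map PartTree.size).sum = F.size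
  | .nil => rfl
  | .cons b F => by
      rw [blocks, Multiset.map_cons, Multiset.sum_cons, sum_size_blocks F]
      rfl

/-- The number of vertices above a vertex, itself included. -/
def PartTree.Vertex.size {D : Type u} (r : PartTree.Vertex D) : ℕ :=
  1 + (r.2.map PartTree.size).sum

/-- The number of vertices of a forest. -/
def PartTree.weight {D : Type u} (s : Multiset (PartTree.Vertex D)) : ℕ :=
  (s.map PartTree.Vertex.size).sum

theorem PlanarBlock.weight_roots {D : Type u} :
    (b : PlanarBlock D) → PartTree.weight b.roots = b.size
  | .single d c => by
      simp [roots, PartTree.weight, PartTree.Vertex.size, PlanarBlocks.sum_size_blocks, size]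
  | .cons d c b => by
      have h := weight_roots b
      rw [PartTree.weight] at h
      simp [roots, PartTree.weight, PartTree.Vertex.size, PlanarBlocks.sum_size_blocks, size, h]

namespace PartTree

variable {D : Type u}

theorem weight_roots (t : PartTree D) : weight t.roots = t.size := by
  induction t using Quotient.inductionOn with | _ b
  exact b.weight_roots

theorem weight_add (s s' : Multiset (Vertex D)) : weight (s + s') = weight s + weight s' := by
  simp [weight]

theorem weight_bind_roots (c : Multiset (PartTree D)) :
    weight (c.bind roots) = (c.map size).sum := by
  induction c using Multiset.induction with
  | empty => rfl
  | cons t c ih =>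
    rw [Multiset.cons_bind, weight_add, ih, weight_roots, Multiset.map_cons, Multiset.sum_cons]

theorem size_le_weight {s : Multiset (Vertex D)} {r : Vertex D} (h : r ∈ s) :
    r.size ≤ weight s :=
  Multiset.single_le_sum (fun _ _ => Nat.zero_le _) _ (Multiset.mem_map_of_mem _ h)

/-- All the vertices above `r` together number `r.size - 1`. -/
theorem size_lt_of_mem_bind_roots {r r' : Vertex D} (h : r' ∈ r.2.bind roots) :
    r'.size < r.size := by
  have := size_le_weight h
  rw [weight_bind_roots] at this
  rw [Vertex.size.eq_1 r]
  omega

open Classical in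
theorem weight_removeRoot {s : Multiset (Vertex D)} {r : Vertex D} (h : r ∈ s) :
    weight (s.erase r + r.2.bind roots) + 1 = weight s := by
  conv_rhs => rw [← Multiset.cons_erase h]
  rw [weight_add, weight_bind_roots]
  simp only [weight, Multiset.map_cons, Multiset.sum_cons, Vertex.size]
  omega

/-! ### Rooted forests -/

/-- The forest whose roots are the elements of `s` consists of rooted trees. -/
def IsRootedForest (s : Multiset (Vertex D)) : Prop :=
  ∀ r ∈ s, ∀ t ∈ r.2, t.IsRootedTree

theorem _root_.PlanarBlocks.AreRootedTrees.isRootedTree_of_mem_blocks :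
    {F : PlanarBlocks D} → F.AreRootedTrees → ∀ t ∈ F.blocks, t.IsRootedTree
  | .nil, _, t, ht => by simp [PlanarBlocks.blocks] at ht
  | .cons b F, hF, t, ht => by
      rw [PlanarBlocks.blocks, Multiset.mem_cons] at ht
      obtain rfl | ht := ht
      · exact ⟨b, hF.1, rfl⟩
      · exact isRootedTree_of_mem_blocks hF.2 t ht

theorem IsRootedTree.exists_roots_eq {t : PartTree D} (h : t.IsRootedTree) :
    ∃ r : Vertex D, t.roots = {r} ∧ addVertex r none = t ∧ ∀ t' ∈ r.2, t'.IsRootedTree := by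
  obtain ⟨b, hb, rfl⟩ := h
  match b, hb with
  | .single d c, hb =>
    refine ⟨(d, c.blocks), rfl, ?_, PlanarBlocks.AreRootedTrees.isRootedTree_of_mem_blocks hb⟩
    rw [addVertex, ofBlocks_blocks]
    rfl

theorem IsRootedTree.isRootedForest_roots {t : PartTree D} (h : t.IsRootedTree) :
    IsRootedForest t.roots := by
  obtain ⟨r, hr, -, hr'⟩ := h.exists_roots_eq
  rw [hr]
  intro r' h
  rw [Multiset.mem_singleton] at h
  rwa [h]

/-- Each block has a single root, so the forest of children still determines the multiset of blocks.
With larger blocks, `bind roots` would forget how the children are grouped; this is where the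
restriction to rooted trees matters. -/
theorem map_addVertex_bind_roots {c : Multiset (PartTree D)} (hc : ∀ t ∈ c, t.IsRootedTree) :
    (c.bind roots).map (fun r => addVertex r none) = c := by
  induction c using Multiset.induction with
  | empty => rfl
  | cons t c ih =>
    obtain ⟨r, hr, hr', -⟩ := (hc t (Multiset.mem_cons_self t c)).exists_roots_eq
    rw [Multiset.cons_bind, Multiset.map_add, ih fun t ht => hc t (Multiset.mem_cons_of_mem ht),
      hr, Multiset.map_singleton, hr', Multiset.singleton_add]

theorem IsRootedForest.add {s s' : Multiset (Vertex D)} (h : IsRootedForest s)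
    (h' : IsRootedForest s') : IsRootedForest (s + s') := fun r hr =>
  (Multiset.mem_add.1 hr).elim (h r) (h' r)

open Classical in
theorem IsRootedForest.removeRoot {s : Multiset (Vertex D)} (h : IsRootedForest s) {r : Vertex D}
    (hr : r ∈ s) : IsRootedForest (s.erase r + r.2.bind roots) := by
  refine IsRootedForest.add (fun r' hr' => h r' (Multiset.mem_of_mem_erase hr')) fun r' hr' => ?_
  obtain ⟨t, ht, hr'⟩ := Multiset.mem_bind.1 hr'
  exact (h r hr t ht).isRootedForest_roots r' hr'

open Classical in
/-- A rooted forest is determined by the removal of a root `r` whose tree has the smallest number of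
vertices, among the forests without smaller trees and the roots of the same type as `r`. -/
theorem IsRootedForest.eq_of_removeRoot_eq {s s' : Multiset (Vertex D)} (h : IsRootedForest s)
    (h' : IsRootedForest s') {r r' : Vertex D} (hr : r ∈ s) (hr' : r' ∈ s')
    (hd : r'.1 = r.1) (hk : Multiset.card r'.2 = Multiset.card r.2)
    (hmin : ∀ q ∈ s, r.size ≤ q.size) (hmin' : ∀ q ∈ s', r.size ≤ q.size)
    (heq : s'.erase r' + r'.2.bind roots = s.erase r + r.2.bind roots) : r' = r ∧ s' = s := by
  -- Trees smaller than that of `r` do not occur in `s` or `s'`. The filter thus keeps all children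
  -- of `r` on one side, and some children of `r'` on the other: the tree of `r'` may be larger than
  -- that of `r`.
  have key := congrArg (Multiset.filter fun q => q.size < r.size) heq
  have e (q₀ : Vertex D) {p : Multiset (Vertex D)} (hp : ∀ q ∈ p, r.size ≤ q.size) :
      (p.erase q₀).filter (fun q => q.size < r.size) = 0 :=
    Multiset.filter_eq_nil.2 fun q hq => (hp q (Multiset.mem_of_mem_erase hq)).not_gt
  rw [Multiset.filter_add, Multiset.filter_add, e r hmin, e r' hmin', zero_add, zero_add,
    Multiset.filter_eq_self.2 fun q hq => size_lt_of_mem_bind_roots hq] at key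
  have hle : r.2.bind roots ≤ r'.2.bind roots := key ▸ Multiset.filter_le _ _
  have card_eq {c : Multiset (PartTree D)} (hc : ∀ t ∈ c, t.IsRootedTree) :
      Multiset.card (c.bind roots) = Multiset.card c := by
    conv_rhs => rw [← map_addVertex_bind_roots hc, Multiset.card_map]
  have hb : r.2.bind roots = r'.2.bind roots := by
    -- The inclusion is an equality because both roots have the same number of children: one for
    -- each block.
    refine Multiset.eq_of_le_of_card_le hle ?_
    rw [card_eq (h r hr), card_eq (h' r' hr'), hk]
  have h2 : r'.2 = r.2 := by
    rw [← map_addVertex_bind_roots (h r hr), hb, map_addVertex_bind_roots (h' r' hr')]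
  obtain rfl : r' = r := Prod.ext hd h2
  refine ⟨rfl, ?_⟩
  rw [← Multiset.cons_erase hr, ← Multiset.cons_erase hr', add_right_cancel heq]

end PartTree

noncomputable section

/-! ### Biwords of forests -/

namespace PartTree

variable {K : Type v} [Field K] {D : Type u}

/-- The shuffle product of the images of the elements of a multiset of partitioned trees. -/
def blocksBiword (K : Type v) [Field K] (c : Multiset (PartTree D)) : Biwords K D :=
  c.foldr (fun t w => shuffle K _ (t.biword K) w) (Finsupp.single [] 1)

/-- The image of a vertex with the blocks of its children. -/
def Vertex.biword (K : Type v) [Field K] (r : Vertex D) : Biwords K D :=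
  TensorWords.cons K _ (Finsupp.single (Multiset.card r.2, r.1) 1) (blocksBiword K r.2)

/-- The shuffle product of the images of the roots of a forest. -/
def forestBiword (K : Type v) [Field K] (s : Multiset (Vertex D)) : Biwords K D :=
  s.foldr (fun r w => shuffle K _ (r.biword K) w) (Finsupp.single [] 1)

theorem forestBiword_cons (r : Vertex D) (s : Multiset (Vertex D)) :
    forestBiword K (r ::ₘ s) = shuffle K _ (r.biword K) (forestBiword K s) :=
  Multiset.foldr_cons _ _ _ _

theorem forestBiword_add (s s' : Multiset (Vertex D)) :
    forestBiword K (s + s') = shuffle K _ (forestBiword K s) (forestBiword K s') := by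
  induction s using Multiset.induction with
  | empty => rw [zero_add, forestBiword.eq_1 K 0, Multiset.foldr_zero, nil_shuffle]
  | cons r s ih => rw [Multiset.cons_add, forestBiword_cons, ih, forestBiword_cons, shuffle_assoc]

theorem _root_.PlanarBlocks.biword_eq_blocksBiword :
    (F : PlanarBlocks D) → F.biword K = blocksBiword K F.blocks
  | .nil => by rw [PlanarBlocks.biword]; rfl
  | .cons b F => by
      rw [PlanarBlocks.biword, PlanarBlocks.biword_eq_blocksBiword F, PlanarBlocks.blocks,
        blocksBiword, blocksBiword, Multiset.foldr_cons]
      rfl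

theorem _root_.PlanarBlock.forestBiword_roots :
    (b : PlanarBlock D) → forestBiword K b.roots = b.biword K
  | .single d c => by
      rw [PlanarBlock.roots, forestBiword, Multiset.foldr_singleton, shuffle_nil, Vertex.biword,
        PlanarBlock.biword, PlanarBlocks.biword_eq_blocksBiword]
  | .cons d c b => by
      rw [PlanarBlock.roots, forestBiword_cons, PlanarBlock.forestBiword_roots b, Vertex.biword,
        PlanarBlock.biword, PlanarBlocks.biword_eq_blocksBiword]

theorem forestBiword_roots (t : PartTree D) : forestBiword K t.roots = t.biword K := by
  induction t using Quotient.inductionOn with | _ b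
  exact b.forestBiword_roots

theorem forestBiword_bind_roots (c : Multiset (PartTree D)) :
    forestBiword K (c.bind roots) = blocksBiword K c := by
  induction c using Multiset.induction with
  | empty => rfl
  | cons t c ih =>
    rw [Multiset.cons_bind, forestBiword_add, ih, forestBiword_roots, blocksBiword, blocksBiword,
      Multiset.foldr_cons]

open Classical in
-- The derivation acts on one root at a time. The image of a root starts with its own letter,
-- followed by the shuffle of its blocks; this shuffle is also the image of the forest of its
-- children, whatever their partition into blocks.
theorem headDeriv_forestBiword (p : ℕ × D) (s : Multiset (Vertex D)) :
    headDeriv K p (forestBiword K s) =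
      (s.map fun r => if p = (Multiset.card r.2, r.1) then
        forestBiword K (s.erase r + r.2.bind roots) else 0).sum := by
  induction s using Multiset.induction with
  | empty => exact headDeriv_nil p
  | cons r s ih =>
    rw [forestBiword_cons, headDeriv_shuffle, ih, Vertex.biword, headDeriv_cons, Multiset.map_cons,
      Multiset.sum_cons, Multiset.erase_cons_head, forestBiword_add, forestBiword_bind_roots,
      ← Vertex.biword.eq_1 K r, LinearMap.map_multiset_sum_map]
    congr 1
    · split_ifs
      · exact shuffle_comm _ _
      · simp
    · congr 1
      refine Multiset.map_congr rfl fun r' hr' => ?_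
      split_ifs
      · rw [Multiset.erase_cons_tail_of_mem hr', Multiset.cons_add, forestBiword_cons]
      · simp

/-! ### Removal of roots and injectivity -/

/-- The space with basis the forests, the empty one included. -/
abbrev ForestModule (K : Type v) [Field K] (D : Type u) : Type (max u v) :=
  Multiset (Vertex D) →₀ K

/-- The image of a forest in `T(V_D, f_D)`, extended linearly. -/
def forestToBiwords (K : Type v) [Field K] (D : Type u) : ForestModule K D →ₗ[K] Biwords K D :=
  Finsupp.linearCombination K (forestBiword K)

open Classical in
/-- The sum of the forests obtained from `s` by the removal of a root with decoration `p.2` and with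
`p.1` blocks of children. -/
def removeRoots (K : Type v) [Field K] (p : ℕ × D) (s : Multiset (Vertex D)) : ForestModule K D :=
  (s.map fun r => if p = (Multiset.card r.2, r.1) then
    Finsupp.single (s.erase r + r.2.bind roots) (1 : K) else 0).sum

/-- The linear extension of `removeRoots`. -/
def rootDeriv (K : Type v) [Field K] (p : ℕ × D) : ForestModule K D →ₗ[K] ForestModule K D :=
  Finsupp.linearCombination K (removeRoots K p)

theorem forestToBiwords_rootDeriv (p : ℕ × D) (P : ForestModule K D) :
    forestToBiwords K D (rootDeriv K p P) = headDeriv K p (forestToBiwords K D P) := by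
  induction P using induction_basis with
  | zero => simp
  | add u u' h h' => simp only [map_add, h, h']
  | smul c u h => simp only [map_smul, h]
  | basis s =>
    simp only [rootDeriv, forestToBiwords, Finsupp.linearCombination_single, one_smul,
      headDeriv_forestBiword, removeRoots, LinearMap.map_multiset_sum_map, apply_ite, map_zero]

theorem rootDeriv_mem_supported (p : ℕ × D) {N : ℕ} {P : ForestModule K D}
    (hP : P ∈ Finsupp.supported K K {s | IsRootedForest s ∧ weight s < N + 1}) :
    rootDeriv K p P ∈ Finsupp.supported K K {s | IsRootedForest s ∧ weight s < N} := by
  rw [rootDeriv, Finsupp.linearCombination_apply]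
  refine Submodule.sum_mem _ fun s hs => Submodule.smul_mem _ _ (multiset_sum_mem _ fun x hx => ?_)
  obtain ⟨r, hr, rfl⟩ := Multiset.mem_map.1 hx
  have hs := hP hs
  split_ifs
  · refine Finsupp.single_mem_supported K _ ⟨hs.1.removeRoot hr, ?_⟩
    have := weight_removeRoot hr
    have := hs.2
    omega
  · exact Submodule.zero_mem _

theorem sum_map_ite_eq {ι : Type*} [DecidableEq ι] (i : ι) (s : Multiset ι) :
    (s.map fun j => if j = i then (1 : K) else 0).sum = Multiset.count i s := by
  induction s using Multiset.induction with
  | empty => simp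
  | cons j s ih =>
    rw [Multiset.map_cons, Multiset.sum_cons, ih, Multiset.count_cons, Nat.cast_add, add_comm]
    simp only [eq_comm, Nat.cast_ite, Nat.cast_one, Nat.cast_zero]

/-- A nonempty forest in the support leads to a nonzero coefficient in one of the derivatives, found
by removing a root whose tree is minimal over the whole support. -/
theorem eq_zero_of_rootDeriv_eq_zero [CharZero K] {P : ForestModule K D}
    (hP : ∀ s ∈ P.support, IsRootedForest s) (h : ∀ p, rootDeriv K p P = 0) :
    ∀ s ∈ P.support, s = 0 := by
  classical
  by_contra! hne
  obtain ⟨s₀, hs₀, hne⟩ := hne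
  obtain ⟨r₀, hr₀⟩ := Multiset.exists_mem_of_ne_zero hne
  have hex : ∃ n, ∃ s ∈ P.support, ∃ r ∈ s, r.size = n := ⟨_, s₀, hs₀, r₀, hr₀, rfl⟩
  obtain ⟨s, hs, r, hr, hn⟩ := Nat.find_spec hex
  have hmin : ∀ s' ∈ P.support, ∀ q ∈ s', r.size ≤ q.size := fun s' hs' q hq =>
    hn ▸ Nat.find_min' hex ⟨s', hs', q, hq, rfl⟩
  -- The coefficient to examine: the forest left by the minimal root `r`, in the derivative for the
  -- letter of `r`.
  have hzero := DFunLike.congr_fun (h (Multiset.card r.2, r.1)) (s.erase r + r.2.bind roots)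
  -- Only the occurrences of `r` in `s` itself contribute, by minimality of `r`.
  have coeff {s'} (hs' : s' ∈ P.support) :
      removeRoots K (Multiset.card r.2, r.1) s' (s.erase r + r.2.bind roots) =
        if s' = s then (Multiset.count r s : K) else 0 := by
    have : removeRoots K (Multiset.card r.2, r.1) s' (s.erase r + r.2.bind roots) =
        (s'.map fun r' => if r' = r ∧ s' = s then (1 : K) else 0).sum := by
      rw [removeRoots, ← Finsupp.lapply_apply (R := K), LinearMap.map_multiset_sum_map]
      refine congrArg _ (Multiset.map_congr rfl fun r' hr' => ?_)
      rw [Finsupp.lapply_apply]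
      by_cases hr's : r' = r ∧ s' = s
      · obtain ⟨rfl, rfl⟩ := hr's
        simp
      · rw [if_neg hr's]
        split_ifs with hp
        · rw [Finsupp.single_apply, if_neg]
          intro heq
          exact hr's ((hP s hs).eq_of_removeRoot_eq (hP s' hs') hr hr' (congrArg Prod.snd hp).symm
            (congrArg Prod.fst hp).symm (hmin s hs) (hmin s' hs') heq)
        · rfl
    rw [this]
    split_ifs with hss
    · subst hss
      simp only [and_true]
      exact sum_map_ite_eq r s'
    · simp [hss]
  -- The coefficient reduces to `P s * count r s`; characteristic zero turns the vanishing of the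
  -- second factor into that of a natural number.
  rw [rootDeriv, Finsupp.linearCombination_apply, Finsupp.sum_apply, Finsupp.sum,
    Finset.sum_congr rfl fun s' hs' => by rw [Finsupp.smul_apply, coeff hs'], Finset.sum_eq_single s
      (fun s' _ hs' => by rw [if_neg hs', smul_zero]) (fun hs' => (hs' hs).elim), if_pos rfl,
    smul_eq_mul, Finsupp.zero_apply, mul_eq_zero, Nat.cast_eq_zero] at hzero
  exact hzero.elim (Finsupp.mem_support_iff.1 hs) (Multiset.count_ne_zero.2 hr)

/-- Induction on a strict bound `N` for the number of vertices: each derivative stays in the kernel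
and lowers the bound by one. -/
theorem eq_zero_of_forestToBiwords_eq_zero [CharZero K] {N : ℕ} {P : ForestModule K D}
    (hP : P ∈ Finsupp.supported K K {s | IsRootedForest s ∧ weight s < N})
    (h : forestToBiwords K D P = 0) : P = 0 := by
  induction N generalizing P with
  | zero =>
    refine Finsupp.support_eq_empty.1 (Finset.eq_empty_of_forall_notMem fun s hs => ?_)
    exact Nat.not_lt_zero _ (hP hs).2
  | succ N ih =>
    have hsupp := eq_zero_of_rootDeriv_eq_zero (fun s hs => (hP hs).1) fun p =>
      ih (rootDeriv_mem_supported p hP) (by rw [forestToBiwords_rootDeriv, h, map_zero])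
    obtain ⟨a, rfl⟩ : ∃ a, P = Finsupp.single 0 a :=
      ⟨P 0, Finsupp.support_subset_singleton.1 fun s hs => Finset.mem_singleton.2 (hsupp s hs)⟩
    rw [forestToBiwords, Finsupp.linearCombination_single, forestBiword, Multiset.foldr_zero,
      Finsupp.smul_single, smul_eq_mul, mul_one, Finsupp.single_eq_zero] at h
    rw [h, Finsupp.single_zero]

theorem forestToBiwords_mapDomain (x : ComPrelie K D) :
    forestToBiwords K D (Finsupp.mapDomain roots x) = ComPrelie.toBiwords K D x := by
  rw [forestToBiwords, Finsupp.linearCombination_mapDomain, ComPrelie.toBiwords]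
  congr 2
  exact funext forestBiword_roots

end PartTree

open PartTree

-- Injectivity on the subalgebra generated by the rooted trees

theorem Prelie.le_forestAlgebra (K : Type v) [Field K] (D : Type u) :
    Prelie K D ≤ forestAlgebra K D :=
  le_sInf fun _ h => h.1

/-- Merging adds the multisets of roots, so combinations of rooted forests are stable under the
product. This inclusion is all that injectivity needs. -/
theorem forestAlgebra_le_supported (K : Type v) [Field K] (D : Type u) :
    forestAlgebra K D ≤ Finsupp.supported K K {t | IsRootedForest t.roots} := by
  refine sInf_le ⟨Submodule.span_le.2 ?_, fun x hx y hy => ?_⟩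
  · rintro _ ⟨t, ht, rfl⟩
    exact Finsupp.single_mem_supported K _ ht.isRootedForest_roots
  · rw [ComPrelie.shuffle, Finsupp.linearCombination_apply, Finsupp.sum, LinearMap.sum_apply]
    refine Submodule.sum_mem _ fun t ht => ?_
    rw [LinearMap.smul_apply, Finsupp.linearCombination_apply]
    refine Submodule.smul_mem _ _ (Submodule.sum_mem _ fun t' ht' => Submodule.smul_mem _ _
      (Finsupp.single_mem_supported K _ ?_))
    rw [Set.mem_ofPred_eq, roots_merge]
    exact (hx ht).add (hy ht')

theorem injOn_toBiwords_forestAlgebra (K : Type v) [Field K] [CharZero K] (D : Type u) :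
    Set.InjOn (ComPrelie.toBiwords K D) (forestAlgebra K D) := by
  intro x hx y hy hxy
  rw [← sub_eq_zero]
  refine Finsupp.mapDomain_injective roots_injective ?_
  rw [Finsupp.mapDomain_zero]
  have hmem := forestAlgebra_le_supported K D (Submodule.sub_mem _ hx hy)
  set z := x - y
  -- The support is finite, so one more than its largest weight is a strict bound.
  refine eq_zero_of_forestToBiwords_eq_zero
    (N := (Finsupp.mapDomain roots z).support.sup weight + 1) (fun s hs => ⟨?_, ?_⟩) ?_
  · classical
    obtain ⟨t, ht, rfl⟩ := Finset.mem_image.1 (Finsupp.mapDomain_support hs)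
    exact hmem ht
  · exact Nat.lt_succ_of_le (Finset.le_sup (f := weight) hs)
  · rw [forestToBiwords_mapDomain, map_sub, hxy, sub_self]

end

theorem theorem31 (K : Type*) [Field K] [CharZero K] (D : Type*) :
    ∃ (Φ_CPL : ComPrelie K D →ₗ[K] Biwords K D) (Φ_PL : Prelie K D →ₗ[K] Biwords K D),
      (IsPhiCPL Φ_CPL ∧ ∀ Ψ : ComPrelie K D →ₗ[K] Biwords K D, IsPhiCPL Ψ → Ψ = Φ_CPL) ∧
      (IsPhiPL Φ_PL ∧ ∀ ψ : Prelie K D →ₗ[K] Biwords K D, IsPhiPL ψ → ψ = Φ_PL) ∧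
      Φ_PL = Φ_CPL.domRestrict (Prelie K D) ∧
      Function.Injective Φ_PL ∧
      Set.InjOn Φ_CPL (forestAlgebra K D) := by
  have hΦ := ComPrelie.isPhiCPL_toBiwords K D
  have hinj := injOn_toBiwords_forestAlgebra K D
  refine ⟨ComPrelie.toBiwords K D, (ComPrelie.toBiwords K D).domRestrict (Prelie K D),
    ⟨hΦ, fun Ψ hΨ => hΨ.ext hΦ⟩, ⟨hΦ.domRestrict, fun ψ hψ => hψ.ext hΦ.domRestrict⟩, rfl,
    fun x y hxy => Subtype.ext ?_, hinj⟩
  -- The rooted trees lie in the forest algebra, so the second injectivity contains the first.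
  exact hinj (Prelie.le_forestAlgebra K D x.2) (Prelie.le_forestAlgebra K D y.2) hxy
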